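/- Let $a<b$ be real numbers, $\lambda>0$, and let $K:[0,\infty)\to[0,\infty)$ satisfy (K1) $K$ is lower semicontinuous and non-decreasing, with $K(0)=0$; (K2) for every $M>0$ there is a constant $C_M>0$ such that $K(\rho_1)+K(\rho_2)\ge K(\rho_1+\rho_2)+C_M\rho_1\rho_2$ for all $\rho_1,\rho_2\ge 0$ with $\rho_1+\rho_2\le M$; (K3) $\lim_{\rho\downarrow 0}K(\rho)/\rho=1$. For $u\in BV(a,b)$, that is, $u\in L^1(a,b)$ whose distributional derivative $Du$ is a finite signed Radon measure on $(a,b)$, let $J_u\subset(a,b)$ be the approximate jump set of $u$ (the points where both one-sided approximate limits $u^{\pm}$ exist and differ), and put $$TV_K(u)=|Du|\bigl((a,b)\setminus J_u\bigr)+\sum_{x\in J_u}K\bigl(|u^+(x)-u^-(x)|\bigr),\qquad TV_{Kg}(u)=TV_K(u)+\frac{\lambda}{2}\int_a^b|u-g|^2\,dx,$$ where $g\in L^\infty(a,b)$. A minimizer of $TV_{Kg}$ is a function $U\in BV(a,b)$ with $TV_{Kg}(U)\le TV_{Kg}(v)$ for all $v\in BV(a,b)$. A function is called piecewise constant with finitely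 many jumps if there is a finite partition $a=t_0<t_1<\dots<t_n=b$ such that it is a.e. equal to a constant on each $(t_i,t_{i+1})$. Then: (i) $TV_{Kg}$ has a minimizer that is piecewise constant with finitely many jumps. (ii) Every minimizer $U$ of $TV_{Kg}$ that is piecewise constant with finitely many jumps satisfies $\operatorname{ess\,inf}_{(a,b)}g\le U\le\operatorname{ess\,sup}_{(a,b)}g$ a.e. on $(a,b)$. (iii) Let $U$ be as in (ii) and let $m$ be the number of points of $J_U$. Let $M>0$ satisfy $M\ge\operatorname{ess\,sup}_{(a,b)}g-\operatorname{ess\,inf}_{(a,b)}g$, let $C_M>0$ be any constant for which the inequality in (K2) holds for this $M$, and let $c_M>0$ be any constant with $K(\rho)\ge c_M\rho$ for all $\rho\in[0,M]$ (such a constant exists by (K1) and (K3)). Then $$m\le\left[\frac{(b-a)\lambda}{A_M}\right]+1,\qquad A_M=\min\left\{\frac{c_M}{M},\,C_M\right\},$$ where $[r]$ denotes the integer part of $r\ge 0$. -/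

import Mathlib

open MeasureTheory Set Filter Topology
open scoped NNReal ENNReal ContDiff

noncomputable section

namespace KWC

/-! ### Functions of bounded variation on `(a, b)`

A function on `(a, b)` is a function `ℝ → ℝ` of which only the values on `Ioo a b`, up to a null
set, matter. -/

/-- The finite signed Radon measure `μ`, carried by `(a, b)`, is the distributional derivative
of `u` on `(a, b)`: `∫ u φ' dx = - ∫ φ dμ` for every test function `φ ∈ C_c^∞(a, b)`. -/
def IsDistribDeriv (a b : ℝ) (u : ℝ → ℝ) (μ : SignedMeasure ℝ) : Prop :=
  (∀ s : Set ℝ, MeasurableSet s → Disjoint s (Ioo a b) → μ s = 0) ∧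
  ∀ φ : ℝ → ℝ, ContDiff ℝ ∞ φ → HasCompactSupport φ → tsupport φ ⊆ Ioo a b →
    ∫ x in Ioo a b, u x * deriv φ x = - ∫ᵛ x, φ x ∂<•μ

/-- `u ∈ BV(a, b)`: `u` is integrable on `(a, b)` and its distributional derivative is a finite
signed measure. -/
def MemBV (a b : ℝ) (u : ℝ → ℝ) : Prop :=
  IntegrableOn u (Ioo a b) ∧ ∃ μ : SignedMeasure ℝ, IsDistribDeriv a b u μ

open scoped Classical in
/-- The distributional derivative `Du` of `u ∈ BV(a, b)` (it is unique; `0` if there is none). -/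
def distribDeriv (a b : ℝ) (u : ℝ → ℝ) : SignedMeasure ℝ :=
  if h : ∃ μ : SignedMeasure ℝ, IsDistribDeriv a b u μ then h.choose else 0

/-! ### Approximate jumps -/

/-- `l` is the one-sided approximate limit of `u` at `x` from the left: the mean of `|u - l|` over
`(x - r, x)` tends to `0` as `r ↓ 0`. -/
def IsLeftTrace (u : ℝ → ℝ) (x l : ℝ) : Prop :=
  Tendsto (fun r : ℝ => ⨍ y in Ioo (x - r) x, |u y - l|) (𝓝[>] 0) (𝓝 0)

/-- `l` is the one-sided approximate limit of `u` at `x` from the right. -/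
def IsRightTrace (u : ℝ → ℝ) (x l : ℝ) : Prop :=
  Tendsto (fun r : ℝ => ⨍ y in Ioo x (x + r), |u y - l|) (𝓝[>] 0) (𝓝 0)

/-- The trace of `u` at `x` from the left (meaningful where it exists, and then unique). -/
def leftTrace (u : ℝ → ℝ) (x : ℝ) : ℝ := Classical.epsilon (IsLeftTrace u x)

/-- The trace of `u` at `x` from the right (meaningful where it exists, and then unique). -/
def rightTrace (u : ℝ → ℝ) (x : ℝ) : ℝ := Classical.epsilon (IsRightTrace u x)

/-- The approximate jump set `J_u` of `u` in `(a, b)`: the points at which both one-sided traces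
exist and differ. -/
def jumpSet (a b : ℝ) (u : ℝ → ℝ) : Set ℝ :=
  {x | x ∈ Ioo a b ∧ ∃ l r : ℝ, IsLeftTrace u x l ∧ IsRightTrace u x r ∧ l ≠ r}

/-! ### The energy -/

/-- `TV_K(u) = |Du|((a, b) \ J_u) + ∑_{x ∈ J_u} K(|u⁺ - u⁻|(x))`. -/
def TVK (a b : ℝ) (K : ℝ≥0 → ℝ≥0) (u : ℝ → ℝ) : ℝ≥0∞ :=
  (distribDeriv a b u).totalVariation (Ioo a b \ jumpSet a b u) +
    ∑' x : jumpSet a b u, (K (nndist (leftTrace u x) (rightTrace u x)) : ℝ≥0∞)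

/-- The fidelity term `(λ/2) ∫_a^b |u - g|² dx`. -/
def fidelity (a b lam : ℝ) (g u : ℝ → ℝ) : ℝ≥0∞ :=
  ENNReal.ofReal (lam / 2) * ∫⁻ x in Ioo a b, ‖u x - g x‖ₑ ^ 2

/-- `TV_{Kg}(u) = TV_K(u) + (λ/2) ∫_a^b |u - g|² dx`. -/
def TVKg (a b lam : ℝ) (K : ℝ≥0 → ℝ≥0) (g u : ℝ → ℝ) : ℝ≥0∞ :=
  TVK a b K u + fidelity a b lam g u

/-- `U` is a minimizer of `TV_{Kg}` in `BV(a, b)`. -/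
def IsMinimizer (a b lam : ℝ) (K : ℝ≥0 → ℝ≥0) (g U : ℝ → ℝ) : Prop :=
  MemBV a b U ∧ ∀ v : ℝ → ℝ, MemBV a b v → TVKg a b lam K g U ≤ TVKg a b lam K g v

/-- `u` is (almost everywhere equal to) a piecewise constant function on `(a, b)` with finitely
many jumps: there is a finite partition `a = t₀ < t₁ < ⋯ < tₙ = b` such that `u` is almost
everywhere constant on each `(tᵢ, tᵢ₊₁)`. -/
def IsPiecewiseConstant (a b : ℝ) (u : ℝ → ℝ) : Prop :=
  ∃ (n : ℕ) (t : Fin (n + 1) → ℝ) (h : Fin n → ℝ),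
    StrictMono t ∧ t 0 = a ∧ t (Fin.last n) = b ∧
    ∀ i : Fin n, ∀ᵐ x ∂volume.restrict (Ioo (t i.castSucc) (t i.succ)), u x = h i

/-! ### Conditions on the jump cost `K` -/

/-- (K1): `K` is lower semicontinuous and non-decreasing with `K(0) = 0`. -/
def CondK1 (K : ℝ≥0 → ℝ≥0) : Prop :=
  LowerSemicontinuous K ∧ Monotone K ∧ K 0 = 0

/-- `C` is an admissible constant `C_M` in (K2) for the given `M`. -/
def IsK2Const (K : ℝ≥0 → ℝ≥0) (M C : ℝ≥0) : Prop :=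
  0 < C ∧ ∀ ρ₁ ρ₂ : ℝ≥0, ρ₁ + ρ₂ ≤ M → K (ρ₁ + ρ₂) + C * ρ₁ * ρ₂ ≤ K ρ₁ + K ρ₂

/-- (K2): for every `M > 0` there is an admissible constant `C_M > 0`. -/
def CondK2 (K : ℝ≥0 → ℝ≥0) : Prop :=
  ∀ M : ℝ≥0, 0 < M → ∃ C : ℝ≥0, IsK2Const K M C

/-- (K3): `K(ρ)/ρ → 1` as `ρ → 0`, `ρ > 0`. -/
def CondK3 (K : ℝ≥0 → ℝ≥0) : Prop :=
  Tendsto (fun ρ : ℝ≥0 => K ρ / ρ) (𝓝[>] 0) (𝓝 1)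

/-- `c` is an admissible constant `c_M` for the given `M`: `c > 0` and `K(ρ) ≥ c ρ` for
`0 ≤ ρ ≤ M`. -/
def IsLowerConst (K : ℝ≥0 → ℝ≥0) (M c : ℝ≥0) : Prop :=
  0 < c ∧ ∀ ρ : ℝ≥0, ρ ≤ M → c * ρ ≤ K ρ

end KWC

end

namespace KWC

/-! ### Distributional derivatives on an interval -/

/-! The problem reduces to a finite-dimensional one. By du Bois-Reymond, an integrable `u` with
derivative `μ` is a.e. `c + μ (Ioc a x)`; traces and jumps can then be read off from `μ`, and `Du`
is unique.

(K2) makes `K` subadditive, and with (K3) this gives `K ρ ≤ ρ` and 1-Lipschitz continuity. Splitting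
`μ` into atoms and the rest gives `K |μ s| ≤ energyMeasure K μ J s` for every measurable `s`
(`le_energyMeasure`). The right side is a measure in `s`, so sampling the primitive along any
increasing sequence produces a step function whose total jump cost is at most `TVK u`
(`sum_jumpCost_le_TVK`). With samples on fine grids the fidelity converges, so a lower bound for the
discrete `energy` of step functions is a lower bound for `TVKg` on all of BV
(`le_TVKg_of_le_energy`).

For step functions, two operations matter. Truncating values to `[lo, hi]`, the range of `g`, lowers
the energy, strictly if a value on a nonempty piece lay outside. Merging an inner piece of length
`l` with a neighbour saves jump cost and changes the fidelity by an amount controlled by `l`; if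
`lam * l < A = min (c / M) C`, one of the two merges strictly pays (`min_le_mul_length`). Hence at
most `⌊(b - a) * lam / A⌋ + 1` jumps are needed, and a minimizer exists by compactness of nodes and
values.

For a given piecewise constant minimizer, a representation with nonempty pieces and distinct
neighbouring values has discrete energy at most `TVKg`, by sampling at midpoints. It therefore
minimizes the discrete energy, and the same two operations give the range and the jump bound. -/

lemma setIntegral_Ici_deriv {a b y : ℝ} {φ : ℝ → ℝ} (hφ : ContDiff ℝ ∞ φ)
    (hs : tsupport φ ⊆ Ioo a b) (hy : y ∈ Ioo a b) :
    ∫ x in Ioo a b, (Ici y).indicator (deriv φ) x = - φ y := by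
  have hb : φ b = 0 := image_eq_zero_of_notMem_tsupport fun h => by simpa using hs h
  have h1 : Differentiable ℝ φ := hφ.differentiable (by simp)
  have h2 : Continuous (deriv φ) := hφ.continuous_deriv (by simp)
  rw [setIntegral_indicator measurableSet_Ici]
  have : Ioo a b ∩ Ici y = Ico y b := by
    ext x; simp only [mem_inter_iff, mem_Ioo, mem_Ici, mem_Ico]
    constructor
    · rintro ⟨⟨_, h⟩, h'⟩; exact ⟨h', h⟩
    · rintro ⟨h', h⟩; exact ⟨⟨hy.1.trans_le h', h⟩, h'⟩
  rw [this, integral_Ico_eq_integral_Ioc, ← intervalIntegral.integral_of_le hy.2.le,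
    intervalIntegral.integral_deriv_eq_sub (fun x _ => h1 x) (h2.intervalIntegrable _ _), hb]
  simp

lemma measurable_real_Ioc (p : Measure ℝ) [IsFiniteMeasure p] (a : ℝ) :
    Measurable fun x => p.real (Ioc a x) :=
  Monotone.measurable fun _ _ h => measureReal_mono (Ioc_subset_Ioc_right h)

lemma integrableOn_real_Ioc_mul {a b : ℝ} (p : Measure ℝ) [IsFiniteMeasure p] {f : ℝ → ℝ}
    (hf : IntegrableOn f (Ioo a b)) :
    IntegrableOn (fun x => p.real (Ioc a x) * f x) (Ioo a b) := by
  refine hf.bdd_mul (c := p.real univ) (measurable_real_Ioc p a).aestronglyMeasurable ?_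
  refine Eventually.of_forall fun x => ?_
  rw [Real.norm_of_nonneg measureReal_nonneg]
  exact measureReal_mono (subset_univ _)

/-- Integration by parts against the distribution function of a finite measure. -/
lemma setIntegral_real_Ioc_mul_deriv {a b : ℝ} (p : Measure ℝ) [IsFiniteMeasure p] {φ : ℝ → ℝ}
    (hφ : ContDiff ℝ ∞ φ) (hs : tsupport φ ⊆ Ioo a b) :
    ∫ x in Ioo a b, p.real (Ioc a x) * deriv φ x = - ∫ y, φ y ∂p := by
  have h2 : Continuous (deriv φ) := hφ.continuous_deriv (by simp)
  have hφi : IntegrableOn (deriv φ) (Ioo a b) :=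
    (h2.integrableOn_Icc).mono_set Ioo_subset_Icc_self
  -- Fubini on the triangle `a < y ≤ x`: the section in `y` yields the distribution function, the
  -- section in `x` yields `-φ y`.
  let S : Set (ℝ × ℝ) := {z | a < z.2 ∧ z.2 ≤ z.1}
  have hS : MeasurableSet S :=
    (measurableSet_lt measurable_const measurable_snd).inter
      (measurableSet_le measurable_snd measurable_fst)
  let f : ℝ → ℝ → ℝ := fun x y => S.indicator (fun z => deriv φ z.1) (x, y)
  have hf : Integrable (Function.uncurry f) ((volume.restrict (Ioo a b)).prod p) := by
    have : Integrable (fun z : ℝ × ℝ => deriv φ z.1) ((volume.restrict (Ioo a b)).prod p) :=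
      hφi.comp_fst p
    exact this.indicator hS
  calc ∫ x in Ioo a b, p.real (Ioc a x) * deriv φ x
      = ∫ x in Ioo a b, ∫ y, f x y ∂p := by
        refine integral_congr_ae (Eventually.of_forall fun x => ?_)
        have : (fun y => f x y) = (Ioc a x).indicator fun _ => deriv φ x := by
          ext y
          by_cases h : y ∈ Ioc a x
          · rw [indicator_of_mem h]; exact indicator_of_mem (s := S) (by exact h) _
          · rw [indicator_of_notMem h]; exact indicator_of_notMem (s := S) (by exact h) _
        simp only [this]
        rw [integral_indicator measurableSet_Ioc, setIntegral_const, smul_eq_mul]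
    _ = ∫ y, (∫ x in Ioo a b, f x y) ∂p := integral_integral_swap hf
    _ = ∫ y, - φ y ∂p := by
        refine integral_congr_ae (Eventually.of_forall fun y => ?_)
        by_cases hy : y ∈ Ioo a b
        · simp only
          rw [← setIntegral_Ici_deriv hφ hs hy]
          refine integral_congr_ae (Eventually.of_forall fun x => ?_)
          by_cases h : y ≤ x
          · simp only [f]
            rw [indicator_of_mem (s := S) (by exact ⟨hy.1, h⟩), indicator_of_mem (by exact h)]
          · simp only [f]
            rw [indicator_of_notMem (s := S) (fun h' => h h'.2), indicator_of_notMem (by exact h)]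
        · have : φ y = 0 := image_eq_zero_of_notMem_tsupport fun h => hy (hs h)
          simp only [this, neg_zero]
          refine setIntegral_eq_zero_of_forall_eq_zero fun x hx => ?_
          refine indicator_of_notMem (s := S) (fun h => hy ⟨h.1, h.2.trans_lt hx.2⟩) _
    _ = - ∫ y, φ y ∂p := integral_neg _

lemma integral_signedMeasure (μ : SignedMeasure ℝ) {φ : ℝ → ℝ} (hφ : Continuous φ)
    (hc : HasCompactSupport φ) :
    ∫ᵛ x, φ x ∂<•μ = ∫ x, φ x ∂μ.toJordanDecomposition.posPart -
      ∫ x, φ x ∂μ.toJordanDecomposition.negPart := by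
  conv_lhs => rw [← μ.toSignedMeasure_toJordanDecomposition, JordanDecomposition.toSignedMeasure]
  rw [VectorMeasure.integral_sub_vectorMeasure, VectorMeasure.integral_toSignedMeasure,
    VectorMeasure.integral_toSignedMeasure]
  all_goals
    rw [VectorMeasure.Integrable, Measure.variation_toSignedMeasure]
    exact hφ.integrable_of_hasCompactSupport hc

lemma setIntegral_deriv_eq_zero {a b : ℝ} {φ : ℝ → ℝ} (hφ : ContDiff ℝ ∞ φ)
    (hs : tsupport φ ⊆ Ioo a b) : ∫ x in Ioo a b, deriv φ x = 0 := by
  rcases le_or_gt b a with h | h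
  · simp [Ioo_eq_empty_of_le h]
  have hz : ∀ y, y ∉ Ioo a b → φ y = 0 := fun y hy =>
    image_eq_zero_of_notMem_tsupport fun h => hy (hs h)
  have h2 : Continuous (deriv φ) := hφ.continuous_deriv (by simp)
  rw [← integral_Ioc_eq_integral_Ioo, ← intervalIntegral.integral_of_le h.le,
    intervalIntegral.integral_deriv_eq_sub
      (fun x _ => (hφ.differentiable (by simp)) x) (h2.intervalIntegrable _ _),
    hz b (by simp), hz a (by simp), sub_zero]

lemma setIntegral_signedMeasure_Ioc_mul_deriv {a b : ℝ} (μ : SignedMeasure ℝ) {φ : ℝ → ℝ}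
    (hφ : ContDiff ℝ ∞ φ) (hc : HasCompactSupport φ) (hs : tsupport φ ⊆ Ioo a b) :
    IntegrableOn (fun x => μ (Ioc a x) * deriv φ x) (Ioo a b) ∧
    ∫ x in Ioo a b, μ (Ioc a x) * deriv φ x = - ∫ᵛ x, φ x ∂<•μ := by
  have h2 : Continuous (deriv φ) := hφ.continuous_deriv (by simp)
  have hφi : IntegrableOn (deriv φ) (Ioo a b) :=
    (h2.integrableOn_Icc).mono_set Ioo_subset_Icc_self
  simp only [μ.apply_eq_posPart_real_sub_negPart_real measurableSet_Ioc, sub_mul]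
  have hp := integrableOn_real_Ioc_mul μ.toJordanDecomposition.posPart hφi
  have hq := integrableOn_real_Ioc_mul μ.toJordanDecomposition.negPart hφi
  refine ⟨hp.sub hq, ?_⟩
  rw [integral_sub hp hq, setIntegral_real_Ioc_mul_deriv _ hφ hs,
    setIntegral_real_Ioc_mul_deriv _ hφ hs, integral_signedMeasure μ hφ.continuous hc]
  ring

/-- The function `c + μ((a, x])` has distributional derivative `μ`. -/
lemma isDistribDeriv_primitive {a b : ℝ} {μ : SignedMeasure ℝ}
    (hμ : ∀ s, MeasurableSet s → Disjoint s (Ioo a b) → μ s = 0) {c : ℝ} {u : ℝ → ℝ}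
    (hu : ∀ᵐ x ∂volume.restrict (Ioo a b), u x = c + μ (Ioc a x)) :
    IsDistribDeriv a b u μ := by
  refine ⟨hμ, fun φ hφ hc hs => ?_⟩
  obtain ⟨hi, he⟩ := setIntegral_signedMeasure_Ioc_mul_deriv μ hφ hc hs
  have h2 : Continuous (deriv φ) := hφ.continuous_deriv (by simp)
  have hφi : IntegrableOn (deriv φ) (Ioo a b) :=
    (h2.integrableOn_Icc).mono_set Ioo_subset_Icc_self
  rw [← he]
  calc ∫ x in Ioo a b, u x * deriv φ x
      = ∫ x in Ioo a b, (c * deriv φ x + μ (Ioc a x) * deriv φ x) := by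
        refine integral_congr_ae (hu.mono fun x hx => ?_)
        simp only [hx]; ring
    _ = _ := by
        rw [integral_add (hφi.const_mul c) hi, integral_const_mul, setIntegral_deriv_eq_zero hφ hs]
        simp

/-- The primitive from `a` vanishes to the left of the support, and to the right of it because the
total integral is zero. Thus mean-zero test functions are exactly the derivatives of test functions.
-/
lemma exists_antideriv_of_integral_eq_zero {a b : ℝ} {θ : ℝ → ℝ} (hθ : ContDiff ℝ ∞ θ)
    (hc : HasCompactSupport θ) (hs : tsupport θ ⊆ Ioo a b) (h0 : ∫ x, θ x = 0) :
    ∃ φ : ℝ → ℝ, ContDiff ℝ ∞ φ ∧ HasCompactSupport φ ∧ tsupport φ ⊆ Ioo a b ∧ deriv φ = θ := by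
  rcases (tsupport θ).eq_empty_or_nonempty with he | hne
  · refine ⟨0, contDiff_const, HasCompactSupport.zero, by simp [tsupport], ?_⟩
    rw [tsupport_eq_empty_iff] at he
    rw [he]; ext x; simp
  obtain ⟨p, hp, hpm⟩ := hc.exists_isMinOn hne continuousOn_id
  obtain ⟨q, hq, hqm⟩ := hc.exists_isMaxOn hne continuousOn_id
  have hK : ∀ y, θ y ≠ 0 → p ≤ y ∧ y ≤ q := fun y hy =>
    ⟨hpm (subset_tsupport _ hy), hqm (subset_tsupport _ hy)⟩
  let φ : ℝ → ℝ := fun x => ∫ y in a..x, θ y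
  have hd : ∀ x, HasDerivAt φ (θ x) x := fun x =>
    intervalIntegral.integral_hasDerivAt_right (hθ.continuous.intervalIntegrable _ _)
      hθ.continuous.stronglyMeasurable.stronglyMeasurableAtFilter hθ.continuous.continuousAt
  have hde : deriv φ = θ := funext fun x => (hd x).deriv
  have hsupp : Function.support φ ⊆ Icc p q := by
    intro x hx
    by_contra hxn
    apply hx
    simp only [φ]
    rcases lt_or_ge x p with h | h
    · rw [intervalIntegral.integral_congr (g := fun _ => 0)]
      · simp
      intro y hy
      by_contra hne
      have h1 := (hK y hne).1
      have h2 : y ≤ max a x := hy.2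
      have := (hs hp).1
      rcases le_max_iff.1 h2 with h3 | h3 <;> linarith
    · have hqx : q < x := by
        by_contra h'; exact hxn ⟨h, not_lt.1 h'⟩
      rw [intervalIntegral.integral_eq_integral_of_support_subset, h0]
      intro y hy
      exact ⟨(hs hp).1.trans_le (hK y hy).1, (hK y hy).2.trans hqx.le⟩
  have hts : tsupport φ ⊆ Icc p q := closure_minimal hsupp isClosed_Icc
  refine ⟨φ, ?_, ?_, ?_, hde⟩
  · rw [contDiff_infty_iff_deriv]
    exact ⟨fun x => (hd x).differentiableAt, hde ▸ hθ⟩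
  · exact isCompact_Icc.of_isClosed_subset (isClosed_tsupport _) hts
  · exact hts.trans fun x hx => ⟨(hs hp).1.trans_le hx.1, hx.2.trans_lt (hs hq).2⟩

/-- The lemma of du Bois-Reymond. -/
lemma ae_eq_const_of_setIntegral_mul_deriv_eq_zero {a b : ℝ} {w : ℝ → ℝ}
    (hw : IntegrableOn w (Ioo a b))
    (h : ∀ φ : ℝ → ℝ, ContDiff ℝ ∞ φ → HasCompactSupport φ → tsupport φ ⊆ Ioo a b →
      ∫ x in Ioo a b, w x * deriv φ x = 0) :
    ∃ c : ℝ, ∀ᵐ x ∂volume.restrict (Ioo a b), w x = c := by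
  rcases le_or_gt b a with hab | hab
  · exact ⟨0, by simp [Ioo_eq_empty_of_le hab]⟩
  -- A fixed test function of integral one, used to correct the mean of an arbitrary test function.
  let f : ContDiffBump ((a + b) / 2) := ⟨(b - a) / 8, (b - a) / 4, by linarith, by linarith⟩
  let ψ : ℝ → ℝ := f.normed volume
  have hψ : ContDiff ℝ ∞ ψ := f.contDiff_normed
  have hψc : HasCompactSupport ψ := f.hasCompactSupport_normed
  have hψs : tsupport ψ ⊆ Ioo a b := by
    rw [f.tsupport_normed_eq, Real.closedBall_eq_Icc]
    intro x hx
    have h1 : (a + b) / 2 - (b - a) / 4 ≤ x := hx.1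
    have h2 : x ≤ (a + b) / 2 + (b - a) / 4 := hx.2
    constructor <;> linarith
  have hψ1 : ∫ x, ψ x = 1 := f.integral_normed
  have bdd : ∀ η : ℝ → ℝ, Continuous η → HasCompactSupport η →
      IntegrableOn (fun x => w x * η x) (Ioo a b) := by
    intro η hη hηc
    obtain ⟨C, hC⟩ := hηc.exists_bound_of_continuous hη
    exact Integrable.mul_bdd (c := C) hw hη.aestronglyMeasurable (Eventually.of_forall hC)
  set c := ∫ x in Ioo a b, w x * ψ x with hcdef
  refine ⟨c, ?_⟩
  have key : ∀ᵐ x, x ∈ Ioo a b → w x - c = 0 := by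
    refine isOpen_Ioo.ae_eq_zero_of_integral_contDiff_smul_eq_zero (f := fun x => w x - c) ?_ ?_
    · exact (hw.sub (integrableOn_const (by simp))).locallyIntegrableOn
    · intro η hη hηc hηs
      have hηi : Integrable η := hη.continuous.integrable_of_hasCompactSupport hηc
      have hψi : Integrable ψ := hψ.continuous.integrable_of_hasCompactSupport hψc
      let θ : ℝ → ℝ := fun x => η x - (∫ y, η y) * ψ x
      have hθc : HasCompactSupport θ := hηc.sub hψc.mul_left
      have hθs : tsupport θ ⊆ Ioo a b := by
        refine (tsupport_sub _ _).trans (union_subset hηs ((closure_mono ?_).trans hψs))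
        exact Function.support_mul_subset_right _ _
      obtain ⟨φ, h1, h2, h3, h4⟩ := exists_antideriv_of_integral_eq_zero (θ := θ)
        (hη.sub (contDiff_const.mul hψ)) hθc hθs (by
          simp only [θ]
          rw [integral_sub hηi (hψi.const_mul _), integral_const_mul, hψ1]; ring)
      have h5 := h φ h1 h2 h3
      rw [h4] at h5
      simp only [θ, mul_sub] at h5
      have h6 : ∀ x, w x * ((∫ y, η y) * ψ x) = (∫ y, η y) * (w x * ψ x) := fun x => by ring
      simp only [h6] at h5
      rw [integral_sub (bdd η hη.continuous hηc) ((bdd ψ hψ.continuous hψc).const_mul _),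
        integral_const_mul, ← hcdef] at h5
      have h7 : ∫ x in Ioo a b, η x = ∫ x, η x :=
        setIntegral_eq_integral_of_forall_compl_eq_zero fun x hx =>
          image_eq_zero_of_notMem_tsupport fun h => hx (hηs h)
      rw [← setIntegral_eq_integral_of_forall_compl_eq_zero (s := Ioo a b) (fun x hx => by
        rw [image_eq_zero_of_notMem_tsupport fun h => hx (hηs h), zero_smul])]
      simp only [smul_eq_mul, mul_sub]
      rw [integral_sub, integral_mul_const, h7]
      · simp only [mul_comm (η _)]; linarith
      · exact (bdd η hη.continuous hηc).congr (Eventually.of_forall fun x => mul_comm _ _)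
      · exact (hηi.integrableOn).mul_const c
  rw [ae_restrict_iff' measurableSet_Ioo]
  exact key.mono fun x hx h => sub_eq_zero.1 (hx h)

/-- A function with distributional derivative `μ` is a primitive of `μ`. -/
lemma IsDistribDeriv.ae_eq_primitive {a b : ℝ} {u : ℝ → ℝ} {μ : SignedMeasure ℝ}
    (hμ : IsDistribDeriv a b u μ) (hu : IntegrableOn u (Ioo a b)) :
    ∃ c : ℝ, ∀ᵐ x ∂volume.restrict (Ioo a b), u x = c + μ (Ioc a x) := by
  have hF : IntegrableOn (fun x => μ (Ioc a x)) (Ioo a b) := by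
    simp only [μ.apply_eq_posPart_real_sub_negPart_real measurableSet_Ioc]
    have h1 : IntegrableOn (fun _ => (1 : ℝ)) (Ioo a b) := integrableOn_const (by simp)
    have hp := integrableOn_real_Ioc_mul μ.toJordanDecomposition.posPart h1
    have hq := integrableOn_real_Ioc_mul μ.toJordanDecomposition.negPart h1
    exact (hp.sub hq).congr (Eventually.of_forall fun x => by simp)
  obtain ⟨c, hc⟩ := ae_eq_const_of_setIntegral_mul_deriv_eq_zero (hu.sub hF) (by
    intro φ hφ hφc hφs
    obtain ⟨hi, he⟩ := setIntegral_signedMeasure_Ioc_mul_deriv μ hφ hφc hφs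
    have h2 := hφ.continuous_deriv (by simp)
    obtain ⟨C, hC⟩ := (hφc.deriv).exists_bound_of_continuous h2
    have h3 : IntegrableOn (fun x => u x * deriv φ x) (Ioo a b) :=
      Integrable.mul_bdd (c := C) hu h2.aestronglyMeasurable (Eventually.of_forall hC)
    simp only [Pi.sub_apply, sub_mul]
    rw [integral_sub h3 hi, he, hμ.2 φ hφ hφc hφs, sub_self])
  exact ⟨c, hc.mono fun x hx => by simp only [Pi.sub_apply] at hx; linarith⟩

end KWC

namespace KWC

/-! ### One-sided traces -/

lemma eventually_real_le_of_iInter_eq_empty (V : Measure ℝ) [IsFiniteMeasure V] {s : ℝ → Set ℝ}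
    (hs : ∀ r, MeasurableSet (s r)) (hm : ∀ i j, i ≤ j → s i ⊆ s j)
    (h0 : ⋂ r > (0 : ℝ), s r = ∅) {ε : ℝ} (hε : 0 < ε) :
    ∀ᶠ r in 𝓝[>] 0, V.real (s r) ≤ ε := by
  have h1 := tendsto_measure_biInter_gt (μ := V) (s := s) (a := 0)
    (fun r _ => (hs r).nullMeasurableSet) (fun i j _ h => hm i j h)
    ⟨1, one_pos, measure_ne_top _ _⟩
  rw [h0, measure_empty] at h1
  have h2 := (ENNReal.tendsto_toReal (by simp : (0 : ℝ≥0∞) ≠ ⊤)).comp h1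
  exact (h2.eventually_lt_const (by simpa using hε)).mono fun r hr => hr.le

/-- Right continuity of the distribution function: the intervals `Ioc x (x + r)` decrease to the
empty set, so their total variation tends to zero. On the left, `Ioo (x - r) x` plays this role and
the limit misses the atom at `x`. -/
lemma eventually_abs_Ioc_sub_le_right (μ : SignedMeasure ℝ) {a x : ℝ} (hx : a ≤ x) {ε : ℝ}
    (hε : 0 < ε) :
    ∀ᶠ r in 𝓝[>] (0 : ℝ), ∀ y ∈ Ioc x (x + r), |μ (Ioc a y) - μ (Ioc a x)| ≤ ε := by
  have h := eventually_real_le_of_iInter_eq_empty μ.totalVariation (s := fun r => Ioc x (x + r))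
    (fun _ => measurableSet_Ioc) (fun i j h => Ioc_subset_Ioc_right (by linarith)) (by
      rw [eq_empty_iff_forall_notMem]
      intro y hy
      simp only [mem_iInter] at hy
      have h1 := (hy 1 one_pos).1
      have h2 := (hy ((y - x) / 2) (by simp; linarith)).2
      linarith) hε
  filter_upwards [h] with r hr y hy
  have h1 : μ (Ioc a y) = μ (Ioc a x) + μ (Ioc x y) := by
    rw [← VectorMeasure.of_union (Ioc_disjoint_Ioc_of_le le_rfl) measurableSet_Ioc
      measurableSet_Ioc, Ioc_union_Ioc_eq_Ioc hx hy.1.le]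
  rw [h1, add_sub_cancel_left]
  refine (μ.norm_le_totalVariation _).trans (le_trans ?_ hr)
  exact measureReal_mono (Ioc_subset_Ioc_right hy.2)

lemma eventually_abs_Ioc_sub_le_left (μ : SignedMeasure ℝ) {a x : ℝ} (hx : a < x) {ε : ℝ}
    (hε : 0 < ε) :
    ∀ᶠ r in 𝓝[>] (0 : ℝ), ∀ y ∈ Ioo (x - r) x, |μ (Ioc a y) - μ (Ioo a x)| ≤ ε := by
  have h := eventually_real_le_of_iInter_eq_empty μ.totalVariation (s := fun r => Ioo (x - r) x)
    (fun _ => measurableSet_Ioo) (fun i j h => Ioo_subset_Ioo_left (by linarith)) (by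
      rw [eq_empty_iff_forall_notMem]
      intro y hy
      simp only [mem_iInter] at hy
      have h1 := (hy 1 one_pos).2
      have h2 := (hy ((x - y) / 2) (by simp; linarith)).1
      linarith) hε
  have h' : ∀ᶠ r in 𝓝[>] (0 : ℝ), r < x - a :=
    mem_nhdsWithin_of_mem_nhds (Iio_mem_nhds (by linarith))
  filter_upwards [h, h'] with r hr hra y hy
  have h1 : μ (Ioo a x) = μ (Ioc a y) + μ (Ioo y x) := by
    rw [← VectorMeasure.of_union _ measurableSet_Ioc measurableSet_Ioo,
      Ioc_union_Ioo_eq_Ioo (by linarith [hy.1]) hy.2]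
    rw [disjoint_left]
    exact fun z hz hz' => absurd hz.2 (not_le.2 hz'.1)
  rw [h1, abs_sub_comm, add_sub_cancel_left]
  refine (μ.norm_le_totalVariation _).trans (le_trans ?_ hr)
  exact measureReal_mono (Ioo_subset_Ioo_left hy.1.le)

/-- Passes from a genuine one-sided limit of the representative `F` to an approximate limit of `u`,
which is known only almost everywhere. -/
lemma tendsto_average_abs_sub {a b L : ℝ} {u F : ℝ → ℝ} {s : ℝ → Set ℝ}
    (hs : ∀ᶠ r in 𝓝[>] (0 : ℝ), s r ⊆ Ioo a b ∧ volume (s r) ≠ 0)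
    (hu : ∀ᵐ x ∂volume.restrict (Ioo a b), u x = F x)
    (hF : ∀ ε > 0, ∀ᶠ r in 𝓝[>] (0 : ℝ), ∀ y ∈ s r, |F y - L| ≤ ε)
    (hm : ∀ r, MeasurableSet (s r)) :
    Tendsto (fun r : ℝ => ⨍ y in s r, |u y - L|) (𝓝[>] 0) (𝓝 0) := by
  rw [Metric.tendsto_nhds]
  intro ε hε
  filter_upwards [hs, hF (ε / 2) (half_pos hε)] with r hr hFr
  have hfin : volume (s r) < ⊤ := (measure_mono hr.1).trans_lt (by simp)
  have hpos : 0 < volume.real (s r) := ENNReal.toReal_pos hr.2 hfin.ne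
  rw [dist_zero_right, setAverage_eq, norm_smul, norm_inv, Real.norm_of_nonneg hpos.le]
  have h1 : ‖∫ y in s r, |u y - L|‖ ≤ ε / 2 * volume.real (s r) := by
    refine norm_setIntegral_le_of_norm_le_const_ae hfin ?_
    filter_upwards [ae_restrict_of_ae_restrict_of_subset hr.1 hu, ae_restrict_mem (hm r)] with y hy hys
    rw [norm_abs_eq_norm, hy]
    exact hFr y hys
  rw [inv_mul_lt_iff₀ hpos]
  nlinarith

lemma eq_of_tendsto_average_abs_sub {a b L L' : ℝ} {u : ℝ → ℝ} {s : ℝ → Set ℝ}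
    (hs : ∀ᶠ r in 𝓝[>] (0 : ℝ), s r ⊆ Ioo a b ∧ volume (s r) ≠ 0)
    (hu : IntegrableOn u (Ioo a b))
    (h : Tendsto (fun r : ℝ => ⨍ y in s r, |u y - L|) (𝓝[>] 0) (𝓝 0))
    (h' : Tendsto (fun r : ℝ => ⨍ y in s r, |u y - L'|) (𝓝[>] 0) (𝓝 0)) : L = L' := by
  have h0 := h.add h'
  rw [add_zero] at h0
  have : |L - L'| ≤ 0 := by
    refine ge_of_tendsto h0 ?_
    filter_upwards [hs] with r hr
    have hfin : volume (s r) < ⊤ := (measure_mono hr.1).trans_lt (by simp)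
    have hpos : 0 < volume.real (s r) := ENNReal.toReal_pos hr.2 hfin.ne
    have hui : IntegrableOn u (s r) := hu.mono_set hr.1
    have hc : ∀ c : ℝ, IntegrableOn (fun _ => c) (s r) := fun c => integrableOn_const hfin.ne
    have hi : ∀ c : ℝ, IntegrableOn (fun y => |u y - c|) (s r) := fun c => (hui.sub (hc c)).abs
    rw [setAverage_eq, setAverage_eq, ← smul_add, ← integral_add (hi L) (hi L'), smul_eq_mul,
      le_inv_mul_iff₀ hpos, ← smul_eq_mul, ← setIntegral_const]
    refine integral_mono (hc _) ((hi L).add (hi L')) fun y => ?_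
    have := abs_sub_le L (u y) L'
    rwa [abs_sub_comm L (u y)] at this
  exact sub_eq_zero.1 (abs_nonpos_iff.1 this)

lemma eventually_Ioo_right {a b x : ℝ} (hx : x ∈ Ioo a b) :
    ∀ᶠ r in 𝓝[>] (0 : ℝ), Ioo x (x + r) ⊆ Ioo a b ∧ volume (Ioo x (x + r)) ≠ 0 := by
  have h' : ∀ᶠ r in 𝓝[>] (0 : ℝ), r < b - x :=
    mem_nhdsWithin_of_mem_nhds (Iio_mem_nhds (by linarith [hx.2]))
  filter_upwards [h', self_mem_nhdsWithin] with r hr hr0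
  refine ⟨Ioo_subset_Ioo hx.1.le (by linarith), ?_⟩
  simpa using hr0

lemma eventually_Ioo_left {a b x : ℝ} (hx : x ∈ Ioo a b) :
    ∀ᶠ r in 𝓝[>] (0 : ℝ), Ioo (x - r) x ⊆ Ioo a b ∧ volume (Ioo (x - r) x) ≠ 0 := by
  have h' : ∀ᶠ r in 𝓝[>] (0 : ℝ), r < x - a :=
    mem_nhdsWithin_of_mem_nhds (Iio_mem_nhds (by linarith [hx.1]))
  filter_upwards [h', self_mem_nhdsWithin] with r hr hr0
  refine ⟨Ioo_subset_Ioo (by linarith) hx.2.le, ?_⟩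
  simpa using hr0

section Traces

variable {a b c x : ℝ} {u : ℝ → ℝ} {μ : SignedMeasure ℝ}

lemma isRightTrace_of_ae_eq (hu : ∀ᵐ x ∂volume.restrict (Ioo a b), u x = c + μ (Ioc a x))
    (hx : x ∈ Ioo a b) : IsRightTrace u x (c + μ (Ioc a x)) := by
  refine tendsto_average_abs_sub (eventually_Ioo_right hx) hu (fun ε hε => ?_)
    fun _ => measurableSet_Ioo
  filter_upwards [eventually_abs_Ioc_sub_le_right μ hx.1.le hε] with r hr y hy
  rw [add_sub_add_left_eq_sub]
  exact hr y ⟨hy.1, hy.2.le⟩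

lemma isLeftTrace_of_ae_eq (hu : ∀ᵐ x ∂volume.restrict (Ioo a b), u x = c + μ (Ioc a x))
    (hx : x ∈ Ioo a b) : IsLeftTrace u x (c + μ (Ioo a x)) := by
  refine tendsto_average_abs_sub (eventually_Ioo_left hx) hu (fun ε hε => ?_)
    fun _ => measurableSet_Ioo
  filter_upwards [eventually_abs_Ioc_sub_le_left μ hx.1 hε] with r hr y hy
  rw [add_sub_add_left_eq_sub]
  exact hr y hy

lemma IsRightTrace.unique {l l' : ℝ} (hu : IntegrableOn u (Ioo a b)) (hx : x ∈ Ioo a b)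
    (h : IsRightTrace u x l) (h' : IsRightTrace u x l') : l = l' :=
  eq_of_tendsto_average_abs_sub (eventually_Ioo_right hx) hu h h'

lemma IsLeftTrace.unique {l l' : ℝ} (hu : IntegrableOn u (Ioo a b)) (hx : x ∈ Ioo a b)
    (h : IsLeftTrace u x l) (h' : IsLeftTrace u x l') : l = l' :=
  eq_of_tendsto_average_abs_sub (eventually_Ioo_left hx) hu h h'

lemma signedMeasure_inter_Ioo (hμ : ∀ s, MeasurableSet s → Disjoint s (Ioo a b) → μ s = 0)
    {s : Set ℝ} (hs : MeasurableSet s) : μ (s ∩ Ioo a b) = μ s := by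
  rw [← VectorMeasure.of_add_of_sdiff (hs.inter measurableSet_Ioo) hs inter_subset_left,
    sdiff_self_inter, hμ _ (hs.diff measurableSet_Ioo) disjoint_sdiff_left, add_zero]

lemma Ioo_add_singleton (hx : a < x) : μ (Ioc a x) = μ (Ioo a x) + μ {x} := by
  rw [← VectorMeasure.of_union (by simp) measurableSet_Ioo (measurableSet_singleton x),
    Ioo_union_right hx]

/-- Both primitives equal `u` a.e.; uniqueness of right traces upgrades this to every point, so `(μ
- ν) (Ioc a x)` is constant in `x`. Letting `x` tend to `a` shows that the constant is zero, letting
`x` tend to `b` that the whole interval has measure zero, and half-lines determine a signed measure.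
-/
lemma IsDistribDeriv.unique {ν : SignedMeasure ℝ} (hab : a < b) (hu : IntegrableOn u (Ioo a b))
    (hμ : IsDistribDeriv a b u μ) (hν : IsDistribDeriv a b u ν) : μ = ν := by
  obtain ⟨c, hc⟩ := hμ.ae_eq_primitive hu
  obtain ⟨d, hd⟩ := hν.ae_eq_primitive hu
  have h1 : ∀ x ∈ Ioo a b, (μ - ν) (Ioc a x) = d - c := fun x hx => by
    have := (isRightTrace_of_ae_eq hc hx).unique hu hx (isRightTrace_of_ae_eq hd hx)
    rw [_root_.sub_apply]; linarith
  have hsmall : ∀ᶠ r in 𝓝[>] (0 : ℝ), r < b - a :=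
    mem_nhdsWithin_of_mem_nhds (Iio_mem_nhds (by linarith))
  have h2 : d - c = 0 := by
    by_contra hne
    have := eventually_abs_Ioc_sub_le_right (μ - ν) (le_refl a)
      (half_pos (abs_pos.2 hne))
    obtain ⟨r, ⟨hr, hrb⟩, hr0⟩ := ((this.and hsmall).and self_mem_nhdsWithin).exists
    have hr0' : 0 < r := hr0
    have h3 := hr (a + r) ⟨by linarith, le_rfl⟩
    rw [h1 (a + r) ⟨by linarith, by linarith⟩] at h3
    simp only [Ioc_self, VectorMeasure.empty, sub_zero] at h3
    have := abs_pos.2 hne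
    linarith
  have hz : ∀ s, MeasurableSet s → Disjoint s (Ioo a b) → (μ - ν) s = 0 := fun s hs hd => by
    rw [_root_.sub_apply, hμ.1 s hs hd, hν.1 s hs hd, sub_zero]
  have h4 : (μ - ν) (Ioo a b) = 0 := by
    by_contra hne
    have := eventually_abs_Ioc_sub_le_left (μ - ν) hab (half_pos (abs_pos.2 hne))
    obtain ⟨r, ⟨hr, hrb⟩, hr0⟩ := ((this.and hsmall).and self_mem_nhdsWithin).exists
    have hr0' : 0 < r := hr0
    have h3 := hr (b - r / 2) ⟨by linarith, by linarith⟩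
    rw [h1 (b - r / 2) ⟨by linarith, by linarith⟩, h2, zero_sub, abs_neg] at h3
    have := abs_pos.2 hne
    linarith
  have huniv : (μ - ν) univ = 0 := by
    rw [← signedMeasure_inter_Ioo hz MeasurableSet.univ, univ_inter, h4]
  have : μ - ν = 0 := by
    refine VectorMeasure.ext_of_generateFrom (range Iic) ?_
      (borel_eq_generateFrom_Iic ℝ ▸ BorelSpace.measurable_eq) isPiSystem_Iic (by simpa using huniv)
    rintro _ ⟨x, rfl⟩
    rw [← signedMeasure_inter_Ioo hz measurableSet_Iic, _root_.zero_apply]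
    rcases le_or_gt x a with h | h
    · rw [show Iic x ∩ Ioo a b = ∅ from by
        ext y; simp only [mem_inter_iff, mem_Iic, mem_Ioo, mem_empty_iff_false, iff_false]
        rintro ⟨h1, h2, _⟩; linarith]
      exact VectorMeasure.empty _
    rcases le_or_gt b x with h' | h'
    · rw [inter_eq_right.2 fun y hy => hy.2.le.trans h', h4]
    · rw [show Iic x ∩ Ioo a b = Ioc a x from by
        ext y; simp only [mem_inter_iff, mem_Iic, mem_Ioo, mem_Ioc]
        exact ⟨fun h => ⟨h.2.1, h.1⟩, fun h => ⟨h.2, h.1, h.2.trans_lt h'⟩⟩, h1 x ⟨h, h'⟩, h2]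
  exact sub_eq_zero.1 this

lemma distribDeriv_eq (hab : a < b) (hu : IntegrableOn u (Ioo a b))
    (hμ : IsDistribDeriv a b u μ) : distribDeriv a b u = μ := by
  have h : ∃ μ : SignedMeasure ℝ, IsDistribDeriv a b u μ := ⟨μ, hμ⟩
  rw [distribDeriv, dif_pos h]
  exact h.choose_spec.unique hab hu hμ

lemma jumpSet_eq (hu : IntegrableOn u (Ioo a b)) (hμ : IsDistribDeriv a b u μ) :
    jumpSet a b u = {x | x ∈ Ioo a b ∧ μ {x} ≠ 0} := by
  obtain ⟨c, hc⟩ := hμ.ae_eq_primitive hu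
  ext x
  simp only [jumpSet, mem_ofPred_eq]
  refine and_congr_right fun hx => ?_
  have hl := isLeftTrace_of_ae_eq hc hx
  have hr := isRightTrace_of_ae_eq hc hx
  have hd := Ioo_add_singleton (μ := μ) hx.1
  constructor
  · rintro ⟨l, r, h1, h2, h3⟩ h0
    apply h3
    rw [h1.unique hu hx hl, h2.unique hu hx hr, hd, h0, add_zero]
  · intro h
    refine ⟨_, _, hl, hr, fun h' => h ?_⟩
    linarith

lemma nndist_trace (hu : IntegrableOn u (Ioo a b)) (hμ : IsDistribDeriv a b u μ)
    (hx : x ∈ Ioo a b) : nndist (leftTrace u x) (rightTrace u x) = ‖μ {x}‖₊ := by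
  obtain ⟨c, hc⟩ := hμ.ae_eq_primitive hu
  have hl := isLeftTrace_of_ae_eq hc hx
  have hr := isRightTrace_of_ae_eq hc hx
  have hl' : IsLeftTrace u x (leftTrace u x) := Classical.epsilon_spec (p := IsLeftTrace u x) ⟨_, hl⟩
  have hr' : IsRightTrace u x (rightTrace u x) :=
    Classical.epsilon_spec (p := IsRightTrace u x) ⟨_, hr⟩
  rw [hl'.unique hu hx hl, hr'.unique hu hx hr, nndist_comm, nndist_eq_nnnorm,
    Ioo_add_singleton hx.1]
  congr 1; ring

lemma TVK_eq (K : ℝ≥0 → ℝ≥0) (hab : a < b) (hu : IntegrableOn u (Ioo a b))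
    (hμ : IsDistribDeriv a b u μ) :
    TVK a b K u = μ.totalVariation (Ioo a b \ {x | x ∈ Ioo a b ∧ μ {x} ≠ 0}) +
      ∑' x : {x | x ∈ Ioo a b ∧ μ {x} ≠ 0}, (K ‖μ {(x : ℝ)}‖₊ : ℝ≥0∞) := by
  rw [TVK, distribDeriv_eq hab hu hμ, jumpSet_eq hu hμ]
  congr 1
  exact tsum_congr fun x => by rw [nndist_trace hu hμ x.2.1]

end Traces

end KWC

namespace KWC

/-! ### Elementary properties of the jump cost -/

section JumpCost

variable {K : ℝ≥0 → ℝ≥0}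

lemma CondK2.subadditive (hK2 : CondK2 K) (x y : ℝ≥0) : K (x + y) ≤ K x + K y := by
  -- The summand `1` keeps the bound positive when `x = y = 0`.
  obtain ⟨C, _, hC⟩ := hK2 (x + y + 1) (by positivity)
  exact le_self_add.trans (hC x y le_self_add)

/-- Cut `x` into `n + 1` equal parts: subadditivity gives `K x ≤ (n + 1) * K (x / (n + 1))`, and by
(K3) the right side tends to `x`. -/
lemma le_self_of_conds (hK1 : CondK1 K) (hK2 : CondK2 K) (hK3 : CondK3 K) (x : ℝ≥0) :
    K x ≤ x := by
  rcases eq_or_ne x 0 with rfl | hx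
  · rw [hK1.2.2]
  have hx0 : 0 < x := pos_iff_ne_zero.2 hx
  have h1 : ∀ n : ℕ, ∀ y, K (n * y) ≤ n * K y := by
    intro n y
    induction n with
    | zero => simp [hK1.2.2]
    | succ k ih =>
      push_cast
      rw [add_mul, one_mul, add_mul, one_mul]
      exact (hK2.subadditive _ _).trans (add_le_add_left ih _)
  have h2 : Tendsto (fun n : ℕ => x / ((n : ℝ≥0) + 1)) atTop (𝓝[>] 0) := by
    refine tendsto_nhdsWithin_iff.2 ⟨?_, Eventually.of_forall fun n => by
      rw [mem_Ioi]; positivity⟩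
    have h3 : Tendsto (fun n : ℕ => (x : ℝ) / ((n : ℝ) + 1)) atTop (𝓝 0) := by
      have := (tendsto_one_div_add_atTop_nhds_zero_nat (𝕜 := ℝ)).const_mul (x : ℝ)
      simpa [div_eq_mul_inv] using this
    rw [← NNReal.tendsto_coe]
    simpa using h3
  have h3 := (hK3.comp h2).const_mul x
  rw [mul_one] at h3
  refine ge_of_tendsto h3 (Eventually.of_forall fun n => ?_)
  have hn : ((n : ℝ≥0) + 1) ≠ 0 := by positivity
  have h4 := h1 (n + 1) (x / ((n : ℝ≥0) + 1))
  push_cast at h4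
  rw [mul_div_cancel₀ _ hn] at h4
  simp only [Function.comp_apply]
  refine h4.trans (le_of_eq ?_)
  field_simp

/-- For `y ≤ x`, `K x - K y ≤ K (x - y) ≤ x - y`; with monotonicity, `K` is 1-Lipschitz. -/
lemma continuous_of_conds (hK1 : CondK1 K) (hK2 : CondK2 K) (hK3 : CondK3 K) : Continuous K := by
  have key : ∀ x y : ℝ≥0, (K x : ℝ) - K y ≤ dist x y := by
    intro x y
    rcases le_total x y with h | h
    · have : (K x : ℝ) ≤ K y := hK1.2.1 h
      linarith [dist_nonneg (x := x) (y := y)]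
    · have h1 := hK2.subadditive y (x - y)
      rw [add_tsub_cancel_of_le h] at h1
      have h2 : (K x : ℝ) ≤ K y + K (x - y) := mod_cast h1
      have h3 : (K (x - y) : ℝ) ≤ (x - y : ℝ≥0) := mod_cast le_self_of_conds hK1 hK2 hK3 _
      rw [NNReal.coe_sub h] at h3
      rw [NNReal.dist_eq]
      linarith [le_abs_self ((x : ℝ) - y)]
  refine (LipschitzWith.of_dist_le_mul (K := 1) fun x y => ?_).continuous
  rw [NNReal.coe_one, one_mul, NNReal.dist_eq, abs_le]
  have h1 := key x y
  have h2 := key y x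
  rw [dist_comm] at h2
  constructor <;> linarith

/-- Below some `δ`, (K3) gives `K ρ ≥ ρ / 2`; from `δ` on, monotonicity gives `K ρ ≥ K (δ / 2) ≥ δ /
4`, which is divided by `M + 1` to dominate a multiple of `ρ ≤ M`. -/
lemma exists_isLowerConst (hK1 : CondK1 K) (hK3 : CondK3 K) {M : ℝ≥0} (hM : 0 < M) :
    ∃ c, IsLowerConst K M c := by
  have h1 : ∀ᶠ ρ in 𝓝[>] (0 : ℝ≥0), 1 / 2 < K ρ / ρ :=
    hK3.eventually_const_lt (by norm_num)
  obtain ⟨δ, hδ0, hδ⟩ := (mem_nhdsGT_iff_exists_Ioo_subset).1 h1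
  have hδ0' : (0 : ℝ≥0) < δ := hδ0
  have hlow : ∀ ρ, 0 < ρ → ρ < δ → 1 / 2 * ρ ≤ K ρ := fun ρ h0 hρ => by
    have := (hδ ⟨h0, hρ⟩ : 1 / 2 < K ρ / ρ)
    exact ((lt_div_iff₀ h0).1 this).le
  have hd : δ / 2 < δ := half_lt_self hδ0'
  have hK := hlow (δ / 2) (half_pos hδ0') hd
  have hp : 0 < 1 / 2 * (δ / 2) / (M + 1) := by positivity
  refine ⟨min (1 / 2) (1 / 2 * (δ / 2) / (M + 1)), lt_min (by norm_num) hp, fun ρ hρ => ?_⟩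
  rcases eq_or_ne ρ 0 with rfl | hne
  · simp
  rcases lt_or_ge ρ δ with h | h
  · exact (mul_le_mul_left (min_le_left _ _) _).trans (hlow ρ (pos_iff_ne_zero.2 hne) h)
  · calc min (1 / 2) (1 / 2 * (δ / 2) / (M + 1)) * ρ
        ≤ 1 / 2 * (δ / 2) / (M + 1) * (M + 1) := by
          gcongr
          · exact min_le_right _ _
          · exact hρ.trans le_self_add
      _ = 1 / 2 * (δ / 2) := by field_simp
      _ ≤ K (δ / 2) := hK
      _ ≤ K ρ := hK1.2.1 (hd.le.trans h)

lemma sum_le_sum_of_conds {ι : Type*} (hK1 : CondK1 K) (hK2 : CondK2 K) (s : Finset ι)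
    (f : ι → ℝ≥0) : K (∑ i ∈ s, f i) ≤ ∑ i ∈ s, K (f i) :=
  Finset.le_sum_of_subadditive K hK1.2.2.le hK2.subadditive s f

lemma tsum_le_tsum_of_conds {ι : Type*} (hK1 : CondK1 K) (hK2 : CondK2 K) (hK3 : CondK3 K)
    {f : ι → ℝ≥0} (hf : Summable f) :
    (K (∑' i, f i) : ℝ≥0∞) ≤ ∑' i, (K (f i) : ℝ≥0∞) := by
  have h1 := ((continuous_of_conds hK1 hK2 hK3).tendsto _).comp hf.hasSum
  have h2 := (ENNReal.continuous_coe.tendsto _).comp h1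
  refine le_of_tendsto h2 (Eventually.of_forall fun s => ?_)
  refine le_trans ?_ (ENNReal.sum_le_tsum s)
  simp only [Function.comp_apply]
  exact_mod_cast sum_le_sum_of_conds hK1 hK2 s f

end JumpCost

/-! ### Sampling a primitive does not increase the energy -/

section Sampling

variable {K : ℝ≥0 → ℝ≥0} {a b : ℝ} {u : ℝ → ℝ}

/-- A measurable subset of a singleton is empty or the singleton, so a multiple of a Dirac mass
dominates `μ` there. -/
lemma totalVariation_singleton (μ : SignedMeasure ℝ) (x : ℝ) :
    μ.totalVariation {x} = ‖μ {x}‖ₑ := by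
  refine le_antisymm ?_ (μ.enorm_le_totalVariation _)
  rw [μ.totalVariation_eq_variation]
  have := VectorMeasure.variation_apply_le_of_forall_enorm_le (μ := μ) (s := {x})
    (m := ‖μ {x}‖ₑ • Measure.dirac x) (measurableSet_singleton x) (fun E _ hE => by
      rcases subset_singleton_iff_eq.1 hE with rfl | rfl <;> simp)
  simpa using this

lemma countable_atoms (μ : SignedMeasure ℝ) (s : Set ℝ) :
    {x | x ∈ s ∧ μ {x} ≠ 0}.Countable := by
  refine (Measure.countable_meas_pos_of_disjoint_iUnion (μ := μ.totalVariation)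
    (As := fun x : ℝ => {x}) (fun x => measurableSet_singleton x)
    (fun x y h => by simpa using h)).mono fun x hx => ?_
  have : μ.totalVariation {x} ≠ 0 := by
    rw [totalVariation_singleton]; simpa using hx.2
  exact pos_iff_ne_zero.2 this

/-- The energy `TV_K`, localised to a set. -/
noncomputable def energyMeasure (K : ℝ≥0 → ℝ≥0) (μ : SignedMeasure ℝ) (J : Set ℝ) : Measure ℝ :=
  μ.totalVariation.restrict Jᶜ +
    Measure.sum fun x : J => (K ‖μ {(x : ℝ)}‖₊ : ℝ≥0∞) • Measure.dirac (x : ℝ)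

lemma energyMeasure_apply {μ : SignedMeasure ℝ} {J s : Set ℝ} (hs : MeasurableSet s) :
    energyMeasure K μ J s = μ.totalVariation (s \ J) +
      ∑' x : J, (K ‖μ {(x : ℝ)}‖₊ : ℝ≥0∞) * s.indicator 1 (x : ℝ) := by
  simp only [energyMeasure, Measure.add_apply, Measure.restrict_apply hs, Measure.sum_apply _ hs,
    Measure.smul_apply, smul_eq_mul, Measure.dirac_apply' _ hs, sdiff_eq]

/-- Bound `‖μ s‖` by the variation off `J` plus the sum of the atoms in `J ∩ s`, then apply
countable subadditivity of `K` to the atoms and `K ρ ≤ ρ` to the rest. -/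
lemma le_energyMeasure (hK1 : CondK1 K) (hK2 : CondK2 K) (hK3 : CondK3 K) (μ : SignedMeasure ℝ)
    {J s : Set ℝ} (hJ : J.Countable) (hs : MeasurableSet s) :
    (K ‖μ s‖₊ : ℝ≥0∞) ≤ energyMeasure K μ J s := by
  classical
  rw [energyMeasure_apply hs]
  set V := μ.totalVariation
  let f : J → ℝ≥0 := fun x => if (x : ℝ) ∈ s then ‖μ {(x : ℝ)}‖₊ else 0
  have hJc : Countable J := hJ.to_subtype
  have hV : ∑' x : J, (f x : ℝ≥0∞) = V (s ∩ J) := by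
    have : s ∩ J = ⋃ x : J, s ∩ {(x : ℝ)} := by
      rw [← inter_iUnion, iUnion_coe_set]; simp
    rw [this, measure_iUnion _ (fun x => hs.inter (measurableSet_singleton _))]
    · refine tsum_congr fun x => ?_
      by_cases hx : (x : ℝ) ∈ s
      · rw [inter_eq_right.2 (singleton_subset_iff.2 hx), totalVariation_singleton]
        simp [f, hx, enorm_eq_nnnorm]
      · rw [inter_singleton_eq_empty.2 hx]; simp [f, hx]
    · intro x y hxy
      refine Disjoint.mono inter_subset_right inter_subset_right ?_
      simpa using fun h => hxy (Subtype.ext h)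
  have hsum : Summable f := by
    rw [← ENNReal.tsum_coe_ne_top_iff_summable, hV]; exact measure_ne_top _ _
  obtain ⟨p, hp⟩ : ∃ p : ℝ≥0, (p : ℝ≥0∞) = V (s \ J) :=
    ⟨_, ENNReal.coe_toNNReal (measure_ne_top _ _)⟩
  have h1 : ‖μ s‖₊ ≤ p + ∑' x, f x := by
    rw [← ENNReal.coe_le_coe, ENNReal.coe_add, ENNReal.coe_tsum hsum, hV, hp, add_comm,
      measure_inter_add_sdiff₀ _ hJ.measurableSet.nullMeasurableSet]
    exact μ.enorm_le_totalVariation s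
  calc (K ‖μ s‖₊ : ℝ≥0∞) ≤ (K (p + ∑' x, f x) : ℝ≥0) := by exact_mod_cast hK1.2.1 h1
    _ ≤ (K p + K (∑' x, f x) : ℝ≥0) := by exact_mod_cast hK2.subadditive _ _
    _ ≤ _ := by
      rw [ENNReal.coe_add, ← hp]
      refine add_le_add (by exact_mod_cast le_self_of_conds hK1 hK2 hK3 p)
        ((tsum_le_tsum_of_conds hK1 hK2 hK3 hsum).trans (le_of_eq (tsum_congr fun x => ?_)))
      by_cases hx : (x : ℝ) ∈ s <;> simp [f, hx, hK1.2.2]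

/-- The increments live on disjoint intervals, and `TVK` is the value on `(a, b)` of a measure
dominating `K` of each increment. -/
lemma sum_jumpCost_le_TVK (hK1 : CondK1 K) (hK2 : CondK2 K) (hK3 : CondK3 K) (hab : a < b)
    {μ : SignedMeasure ℝ} (hu : IntegrableOn u (Ioo a b)) (hμ : IsDistribDeriv a b u μ)
    {s : ℕ → ℝ} (hs : Monotone s) (n : ℕ) :
    ∑ i ∈ Finset.range n, (K ‖μ (Ioc (s i) (s (i + 1)))‖₊ : ℝ≥0∞) ≤ TVK a b K u := by
  set J := {x | x ∈ Ioo a b ∧ μ {x} ≠ 0} with hJ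
  have hJc : J.Countable := countable_atoms μ _
  have h1 : TVK a b K u = energyMeasure K μ J (Ioo a b) := by
    rw [TVK_eq K hab hu hμ, energyMeasure_apply measurableSet_Ioo]
    congr 1
    refine tsum_congr fun x => ?_
    rw [indicator_of_mem x.2.1]; simp
  have hm : ∀ i, MeasurableSet (Ioc (s i) (s (i + 1)) ∩ Ioo a b) := fun i =>
    measurableSet_Ioc.inter measurableSet_Ioo
  calc ∑ i ∈ Finset.range n, (K ‖μ (Ioc (s i) (s (i + 1)))‖₊ : ℝ≥0∞)
      ≤ ∑ i ∈ Finset.range n, energyMeasure K μ J (Ioc (s i) (s (i + 1)) ∩ Ioo a b) := by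
        refine Finset.sum_le_sum fun i _ => ?_
        rw [← signedMeasure_inter_Ioo hμ.1 measurableSet_Ioc]
        exact le_energyMeasure hK1 hK2 hK3 μ hJc (hm i)
    _ = energyMeasure K μ J (⋃ i ∈ Finset.range n, Ioc (s i) (s (i + 1)) ∩ Ioo a b) := by
        rw [measure_biUnion_finset _ fun i _ => hm i]
        intro i _ j _ hij
        exact (hs.pairwise_disjoint_on_Ioc_succ hij).mono inter_subset_left inter_subset_left
    _ ≤ TVK a b K u := by
        rw [h1]
        exact measure_mono (iUnion₂_subset fun i _ => inter_subset_right)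

end Sampling

end KWC

namespace KWC

/-! ### Step functions -/

/-- The nodes `a = t₀ ≤ t₁ ≤ ⋯ ≤ tₙ₊₁ = b` of a division of `(a, b)` into `n + 1` pieces. -/
structure IsPartition (a b : ℝ) (n : ℕ) (t : ℕ → ℝ) : Prop where
  mono : Monotone t
  zero : t 0 = a
  eq_right : ∀ j, n + 1 ≤ j → t j = b

/-- `u` is almost everywhere equal to `hᵢ` on `(tᵢ, tᵢ₊₁)` for `i ≤ n`. -/
def IsStep (n : ℕ) (t h : ℕ → ℝ) (u : ℝ → ℝ) : Prop :=
  ∀ i ≤ n, ∀ᵐ x ∂volume.restrict (Ioo (t i) (t (i + 1))), u x = h i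

open scoped Classical in
/-- The right-continuous step function with value `hᵢ` on `[tᵢ, tᵢ₊₁)`. -/
noncomputable def stepFun (n : ℕ) (t h : ℕ → ℝ) (x : ℝ) : ℝ :=
  h 0 + ∑ i ∈ Finset.range n, if t (i + 1) ≤ x then h (i + 1) - h i else 0

/-- The jumps of `stepFun n t h` inside `(a, b)`, as a measure. -/
noncomputable def stepMeasure (a b : ℝ) (n : ℕ) (t h : ℕ → ℝ) : SignedMeasure ℝ :=
  (∑ i ∈ Finset.range n, VectorMeasure.dirac (t (i + 1)) (h (i + 1) - h i)).restrict (Ioo a b)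

section Steps

variable {K : ℝ≥0 → ℝ≥0} {a b : ℝ} {u : ℝ → ℝ} {n : ℕ} {t h : ℕ → ℝ}

lemma stepFun_eq (ht : Monotone t) {j : ℕ} (hj : j ≤ n) {x : ℝ} (hx : x ∈ Ico (t j) (t (j + 1))) :
    stepFun n t h x = h j := by
  classical
  rw [stepFun, ← Finset.sum_subset (Finset.range_mono hj)]
  · rw [Finset.sum_congr rfl (g := fun i => h (i + 1) - h i), Finset.sum_range_sub]
    · ring
    · intro i hi
      exact if_pos ((ht (Finset.mem_range.1 hi)).trans hx.1)
  · intro i _ hi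
    have : j ≤ i := by simpa using hi
    exact if_neg (not_le.2 (hx.2.trans_le (ht (by omega))))

lemma isStep_stepFun (ht : Monotone t) : IsStep n t h (stepFun n t h) := fun _ hi =>
  (ae_restrict_mem measurableSet_Ioo).mono fun _ hx => stepFun_eq ht hi ⟨hx.1.le, hx.2⟩

lemma IsPartition.exists_piece (ht : IsPartition a b n t) {x : ℝ} (hx : x ∈ Ico a b) :
    ∃ i ≤ n, x ∈ Ico (t i) (t (i + 1)) := by
  classical
  have hex : ∃ k, x < t k := ⟨n + 1, by rw [ht.eq_right _ le_rfl]; exact hx.2⟩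
  have h0 : Nat.find hex ≠ 0 := fun h0 => by
    have := Nat.find_spec hex
    rw [h0, ht.zero] at this
    exact absurd this (not_lt.2 hx.1)
  obtain ⟨k, hk⟩ := Nat.exists_eq_succ_of_ne_zero h0
  have h1 : Nat.find hex ≤ n + 1 := Nat.find_min' hex (by rw [ht.eq_right _ le_rfl]; exact hx.2)
  refine ⟨k, by omega, not_lt.1 (Nat.find_min hex (by omega)), ?_⟩
  have := Nat.find_spec hex
  rwa [hk] at this

lemma IsPartition.ae_of_forall (ht : IsPartition a b n t) {p : ℝ → Prop}
    (hp : ∀ i ≤ n, ∀ᵐ x ∂volume.restrict (Ioo (t i) (t (i + 1))), p x) :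
    ∀ᵐ x ∂volume.restrict (Ioo a b), p x := by
  have hn : ∀ i, ∀ᵐ x ∂(volume : Measure ℝ), x ≠ t i := fun i => by
    simp [ae_iff]
  have hp' : ∀ i, ∀ᵐ x ∂(volume : Measure ℝ), i ≤ n → x ∈ Ioo (t i) (t (i + 1)) → p x := by
    intro i
    by_cases hi : i ≤ n
    · exact ((ae_restrict_iff' measurableSet_Ioo).1 (hp i hi)).mono fun x hx _ => hx
    · exact Eventually.of_forall fun x h => absurd h hi
  rw [ae_restrict_iff' measurableSet_Ioo]
  filter_upwards [ae_all_iff.2 hn, ae_all_iff.2 hp'] with x h1 h2 hx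
  obtain ⟨i, hi, hxi⟩ := ht.exists_piece ⟨hx.1.le, hx.2⟩
  exact h2 i hi ⟨lt_of_le_of_ne hxi.1 (h1 i).symm, hxi.2⟩

lemma IsStep.ae_eq_stepFun (ht : IsPartition a b n t) (hu : IsStep n t h u) :
    ∀ᵐ x ∂volume.restrict (Ioo a b), u x = stepFun n t h x :=
  ht.ae_of_forall fun i hi => by
    filter_upwards [hu i hi, isStep_stepFun ht.mono i hi] with x h1 h2
    rw [h1, h2]

lemma measurable_stepFun : Measurable (stepFun n t h) := by
  classical
  refine measurable_const.add (Finset.measurable_sum _ fun i _ => ?_)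
  exact Measurable.ite measurableSet_Ici measurable_const measurable_const

lemma abs_stepFun_le (n : ℕ) (t h : ℕ → ℝ) (x : ℝ) :
    |stepFun n t h x| ≤ |h 0| + ∑ i ∈ Finset.range n, |h (i + 1) - h i| := by
  classical
  refine (abs_add_le _ _).trans (add_le_add le_rfl ((Finset.abs_sum_le_sum_abs _ _).trans
    (Finset.sum_le_sum fun i _ => ?_)))
  split_ifs
  · exact le_rfl
  · simp

lemma IsStep.integrableOn (ht : IsPartition a b n t) (hu : IsStep n t h u) :
    IntegrableOn u (Ioo a b) := by
  have : IntegrableOn (stepFun n t h) (Ioo a b) :=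
    Measure.integrableOn_of_bounded (by simp) measurable_stepFun.aestronglyMeasurable
      (Eventually.of_forall (abs_stepFun_le n t h))
  exact this.congr ((hu.ae_eq_stepFun ht).mono fun x hx => hx.symm)

open scoped Classical in
lemma stepMeasure_apply {s : Set ℝ} (hs : MeasurableSet s) (hsub : s ⊆ Ioo a b) :
    stepMeasure a b n t h s =
      ∑ i ∈ Finset.range n, if t (i + 1) ∈ s then h (i + 1) - h i else 0 := by
  rw [stepMeasure, VectorMeasure.restrict_apply _ measurableSet_Ioo hs, inter_eq_left.2 hsub]
  have : ∀ (v : ℕ → SignedMeasure ℝ) (F : Finset ℕ), (∑ i ∈ F, v i) s = ∑ i ∈ F, v i s := by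
    intro v F
    induction F using Finset.induction_on with
    | empty => simp
    | insert i F hi ih => rw [Finset.sum_insert hi, Finset.sum_insert hi, ← ih]; rfl
  rw [this]
  refine Finset.sum_congr rfl fun i _ => ?_
  split_ifs with hi
  · exact VectorMeasure.dirac_apply_of_mem hs hi
  · exact VectorMeasure.dirac_apply_of_notMem hi

lemma stepMeasure_eq_zero {s : Set ℝ} (hs : MeasurableSet s) (hd : Disjoint s (Ioo a b)) :
    stepMeasure a b n t h s = 0 := by
  rw [stepMeasure, VectorMeasure.restrict_apply _ measurableSet_Ioo hs,
    disjoint_iff_inter_eq_empty.1 hd, VectorMeasure.empty]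

lemma IsStep.isDistribDeriv (ht : IsPartition a b n t) (hu : IsStep n t h u) :
    IsDistribDeriv a b u (stepMeasure a b n t h) := by
  classical
  -- Nodes equal to `a` do not contribute to the measure on `(a, b)`; they are already counted in
  -- the value of the right-continuous step function at `a`.
  refine isDistribDeriv_primitive (fun s => stepMeasure_eq_zero) (c := stepFun n t h a) ?_
  filter_upwards [hu.ae_eq_stepFun ht, ae_restrict_mem measurableSet_Ioo] with x hx hxm
  have hsub : Ioc a x ⊆ Ioo a b := fun y hy => ⟨hy.1, hy.2.trans_lt hxm.2⟩
  rw [hx, stepMeasure_apply measurableSet_Ioc hsub, stepFun, stepFun, add_assoc,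
    ← Finset.sum_add_distrib]
  congr 1
  refine Finset.sum_congr rfl fun i _ => ?_
  by_cases h1 : t (i + 1) ≤ a
  · rw [if_pos h1, if_pos (h1.trans hxm.1.le), if_neg (fun h => absurd h.1 (not_lt.2 h1)), add_zero]
  · simp only [if_neg h1, mem_Ioc, not_le.1 h1, true_and, zero_add]

lemma IsStep.memBV (ht : IsPartition a b n t) (hu : IsStep n t h u) : MemBV a b u :=
  ⟨hu.integrableOn ht, _, hu.isDistribDeriv ht⟩

lemma stepMeasure_singleton_eq_zero {x : ℝ} (hx : x ∈ Ioo a b)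
    (h0 : ∀ i < n, t (i + 1) ≠ x) : stepMeasure a b n t h {x} = 0 := by
  classical
  rw [stepMeasure_apply (measurableSet_singleton x) (singleton_subset_iff.2 hx)]
  exact Finset.sum_eq_zero fun i hi => if_neg (h0 i (Finset.mem_range.1 hi))

/-- The jumps of a step function are among the interior nodes. -/
lemma IsStep.jumpSet_subset (ht : IsPartition a b n t) (hu : IsStep n t h u) :
    jumpSet a b u ⊆ (fun i => t (i + 1)) '' Iio n := by
  rw [jumpSet_eq (hu.integrableOn ht) (hu.isDistribDeriv ht)]
  rintro x ⟨hx, hne⟩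
  by_contra hn
  exact hne (stepMeasure_singleton_eq_zero hx fun i hi h' => hn ⟨i, hi, h'⟩)

lemma totalVariation_stepMeasure_sdiff :
    (stepMeasure a b n t h).totalVariation
      (Ioo a b \ {x | x ∈ Ioo a b ∧ stepMeasure a b n t h {x} ≠ 0}) = 0 := by
  classical
  set μ := stepMeasure a b n t h
  let T : Set ℝ := (fun i => t (i + 1)) '' Iio n
  have hT : T.Countable := (to_countable _).image _
  have h1 : μ.totalVariation (Ioo a b \ T) = 0 := by
    rw [μ.totalVariation_eq_variation,
      VectorMeasure.variation_apply_eq_zero (measurableSet_Ioo.diff hT.measurableSet)]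
    intro s hs hsm
    rw [stepMeasure_apply hsm (hs.trans sdiff_subset)]
    refine Finset.sum_eq_zero fun i hi => if_neg fun h' => (hs h').2 ⟨i, ?_, rfl⟩
    simpa using hi
  have h2 : μ.totalVariation (⋃ x ∈ T ∩ {x | μ {x} = 0}, {x}) = 0 := by
    rw [measure_biUnion_null_iff (hT.mono inter_subset_left)]
    intro x hx
    rw [totalVariation_singleton, hx.2, enorm_zero]
  refine measure_mono_null ?_ (measure_union_null h1 h2)
  intro x hx
  by_cases hxT : x ∈ T
  · right
    simp only [biUnion_of_singleton]
    refine ⟨hxT, ?_⟩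
    by_contra hne
    exact hx.2 ⟨hx.1, hne⟩
  · exact Or.inl ⟨hx.1, hxT⟩

/-- Only an inequality: nodes may coincide, and then the actual jump is the sum of several
differences, whose cost is bounded by subadditivity; differences at an endpoint of `(a, b)` cost
nothing in `TVK`. -/
lemma IsStep.TVK_le (hK1 : CondK1 K) (hK2 : CondK2 K) (hab : a < b) (ht : IsPartition a b n t)
    (hu : IsStep n t h u) :
    TVK a b K u ≤ ∑ i ∈ Finset.range n, (K (nndist (h i) (h (i + 1))) : ℝ≥0∞) := by
  classical
  rw [TVK_eq K hab (hu.integrableOn ht) (hu.isDistribDeriv ht), totalVariation_stepMeasure_sdiff,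
    zero_add]
  set μ := stepMeasure a b n t h
  set J := {x | x ∈ Ioo a b ∧ μ {x} ≠ 0}
  have hJc : Countable J := (countable_atoms μ _).to_subtype
  let Θ : Measure ℝ := ∑ i ∈ Finset.range n,
    (K (nndist (h i) (h (i + 1))) : ℝ≥0∞) • Measure.dirac (t (i + 1))
  calc ∑' x : J, (K ‖μ {(x : ℝ)}‖₊ : ℝ≥0∞) ≤ ∑' x : J, Θ {(x : ℝ)} := by
        refine ENNReal.tsum_le_tsum fun x => ?_
        rw [stepMeasure_apply (measurableSet_singleton _) (singleton_subset_iff.2 x.2.1)]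
        refine le_trans (b := ((∑ i ∈ Finset.range n,
          K (if t (i + 1) ∈ ({(x : ℝ)} : Set ℝ) then nndist (h i) (h (i + 1)) else 0) : ℝ≥0) :
            ℝ≥0∞)) ?_ ?_
        · rw [ENNReal.coe_le_coe]
          refine (hK1.2.1 ((nnnorm_sum_le _ _).trans (le_of_eq (Finset.sum_congr rfl
            fun i _ => ?_)))).trans (sum_le_sum_of_conds hK1 hK2 _ _)
          split_ifs
          · rw [nndist_comm, nndist_eq_nnnorm]
          · simp
        · rw [ENNReal.ofNNReal_finsetSum, Measure.finsetSum_apply]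
          refine Finset.sum_le_sum fun i _ => ?_
          rw [Measure.smul_apply, Measure.dirac_apply' _ (measurableSet_singleton _), smul_eq_mul]
          by_cases hi : t (i + 1) ∈ ({(x : ℝ)} : Set ℝ)
          · rw [if_pos hi, indicator_of_mem hi]; simp
          · rw [if_neg hi, hK1.2.2]; simp
    _ ≤ Θ (⋃ x : J, {(x : ℝ)}) := by
        refine tsum_meas_le_meas_iUnion_of_disjoint _ (fun x => measurableSet_singleton _) ?_
        intro x y hxy
        simpa using fun h => hxy (Subtype.ext h)
    _ ≤ Θ univ := measure_mono (subset_univ _)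
    _ = _ := by simp [Θ, Measure.finsetSum_apply]

end Steps

end KWC

namespace KWC

/-! ### Removing a piece -/

/-- Remove the node with index `i + 1`. -/
def dropNode (i : ℕ) (t : ℕ → ℝ) (j : ℕ) : ℝ := if j ≤ i then t j else t (j + 1)

/-- Remove the value with index `i`. -/
def dropVal (i : ℕ) (h : ℕ → ℝ) (j : ℕ) : ℝ := if j < i then h j else h (j + 1)

/-- The fidelity of the constant `v` on `(s, t)`. -/
noncomputable def pieceCost (g : ℝ → ℝ) (v s t : ℝ) : ℝ := ∫ x in s..t, (v - g x) ^ 2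

/-- The energy of the step function with nodes `t` and values `h`. -/
noncomputable def energy (lam : ℝ) (K : ℝ≥0 → ℝ≥0) (g : ℝ → ℝ) (n : ℕ) (t h : ℕ → ℝ) : ℝ :=
  ∑ i ∈ Finset.range n, (K (nndist (h i) (h (i + 1))) : ℝ) +
    lam / 2 * ∑ i ∈ Finset.range (n + 1), pieceCost g (h i) (t i) (t (i + 1))

section Drop

variable {a b : ℝ} {u : ℝ → ℝ} {n i : ℕ} {t h : ℕ → ℝ}

/-- The removed node must be an inner one, unless the last piece is degenerate, in which case the
final `b` is removed and the node before it takes its role. -/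
lemma IsPartition.dropNode (ht : IsPartition a b (n + 1) t) (hi : i ≤ n ∨ t (n + 1) = b) :
    IsPartition a b n (dropNode i t) where
  mono := by
    refine monotone_nat_of_le_succ fun j => ?_
    simp only [KWC.dropNode]
    split_ifs <;> exact ht.mono (by omega)
  zero := by simp [KWC.dropNode, ht.zero]
  eq_right j hj := by
    simp only [KWC.dropNode]
    split_ifs with h1
    · rcases hi with hi | hi
      · omega
      · rcases hj.eq_or_lt with rfl | hj
        · exact hi
        · exact ht.eq_right j (by omega)
    · exact ht.eq_right _ (by omega)

lemma ae_restrict_Ioo_of_ae {p : ℝ → Prop} {r s t : ℝ}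
    (h1 : ∀ᵐ x ∂volume.restrict (Ioo r s), p x) (h2 : ∀ᵐ x ∂volume.restrict (Ioo s t), p x) :
    ∀ᵐ x ∂volume.restrict (Ioo r t), p x := by
  have hs : ∀ᵐ x ∂(volume : Measure ℝ), x ≠ s := by simp [ae_iff]
  rw [ae_restrict_iff' measurableSet_Ioo] at h1 h2 ⊢
  filter_upwards [h1, h2, hs] with x h1 h2 hs hx
  rcases lt_or_gt_of_ne hs with h | h
  · exact h1 ⟨hx.1, h⟩
  · exact h2 ⟨h, hx.2⟩

lemma IsStep.drop (hu : IsStep (n + 1) t h u) (hi : i ≤ n ∧ h i = h (i + 1) ∨ t i = t (i + 1)) :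
    IsStep n (dropNode i t) (dropVal i h) u := by
  intro j hj
  rcases lt_trichotomy j i with hji | rfl | hji
  · simpa [KWC.dropNode, dropVal, hji, hji.le, Nat.succ_le_of_lt hji] using hu j (by omega)
  · have h2 := hu (j + 1) (by omega)
    simp only [KWC.dropNode, dropVal, le_refl, if_true, lt_irrefl, if_false,
      show ¬ (j + 1 ≤ j) by omega]
    rcases hi with ⟨_, hi⟩ | hi
    · have h1 := hu j (by omega)
      rw [hi] at h1
      exact ae_restrict_Ioo_of_ae h1 h2
    · rwa [hi]
  · simpa [KWC.dropNode, dropVal, show ¬ j ≤ i by omega, show ¬ j < i by omega,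
      show ¬ j + 1 ≤ i by omega] using hu (j + 1) (by omega)

end Drop

/-! ### The discrete energy under merging of pieces -/

section Energy

variable {lam : ℝ} {K : ℝ≥0 → ℝ≥0} {g : ℝ → ℝ} {a b lo hi : ℝ} {n i : ℕ} {t h : ℕ → ℝ}

lemma intervalIntegrable_of_mem_Icc (hgm : Measurable g) (hgb : ∀ x, g x ∈ Icc lo hi) (r s : ℝ) :
    IntervalIntegrable g volume r s := by
  rw [intervalIntegrable_iff]
  refine Measure.integrableOn_of_bounded (M := max |lo| |hi|) measure_Ioc_lt_top.ne
    hgm.aestronglyMeasurable (Eventually.of_forall fun x => ?_)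
  exact abs_le_max_abs_abs (hgb x).1 (hgb x).2

lemma intervalIntegrable_sq (hgm : Measurable g) (hgb : ∀ x, g x ∈ Icc lo hi) (v r s : ℝ) :
    IntervalIntegrable (fun x => (v - g x) ^ 2) volume r s := by
  have : ∀ x, (fun x => (v - g x) ^ 2) x ∈ Icc 0 ((max |v - hi| |v - lo|) ^ 2) := fun x => by
    refine ⟨sq_nonneg _, ?_⟩
    change (v - g x) ^ 2 ≤ _
    rw [← sq_abs (v - g x)]
    refine pow_le_pow_left₀ (abs_nonneg _) ?_ 2
    exact abs_le_max_abs_abs (by linarith [(hgb x).2]) (by linarith [(hgb x).1])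
  exact intervalIntegrable_of_mem_Icc ((measurable_const.sub hgm).pow_const 2) this r s

/-- As a quadratic in `v` its last term does not depend on `v`, so comparing two values on a piece
involves only the length and the integral of `g`. -/
lemma pieceCost_eq (hgm : Measurable g) (hgb : ∀ x, g x ∈ Icc lo hi) (v r s : ℝ) :
    pieceCost g v r s =
      v ^ 2 * (s - r) - 2 * v * (∫ x in r..s, g x) + ∫ x in r..s, (0 - g x) ^ 2 := by
  have h1 := intervalIntegrable_of_mem_Icc hgm hgb r s
  have h2 := intervalIntegrable_sq hgm hgb 0 r s
  have h3 : ∀ x, (v - g x) ^ 2 = v ^ 2 - 2 * v * g x + (0 - g x) ^ 2 := fun x => by ring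
  simp only [pieceCost, h3]
  rw [intervalIntegral.integral_add (intervalIntegrable_const.sub (h1.const_mul _)) h2,
    intervalIntegral.integral_sub intervalIntegrable_const (h1.const_mul _),
    intervalIntegral.integral_const, intervalIntegral.integral_const_mul, smul_eq_mul]
  ring

lemma energy_drop (hK1 : CondK1 K) (hgm : Measurable g) (hgb : ∀ x, g x ∈ Icc lo hi)
    (hin : i ≤ n) (hh : h i = h (i + 1)) :
    energy lam K g n (dropNode i t) (dropVal i h) = energy lam K g (n + 1) t h := by
  obtain ⟨r, rfl⟩ := Nat.exists_eq_add_of_le hin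
  have e1 : ∑ j ∈ Finset.range (i + r),
      (K (nndist (dropVal i h j) (dropVal i h (j + 1))) : ℝ) =
      ∑ j ∈ Finset.range (i + r + 1), (K (nndist (h j) (h (j + 1))) : ℝ) := by
    rw [add_assoc, add_comm r 1, Finset.sum_range_add, Finset.sum_range_add,
      Finset.sum_range_add (n := 1)]
    congr 1
    · refine Finset.sum_congr rfl fun j hj => ?_
      have hj := Finset.mem_range.1 hj
      rcases (Nat.succ_le_of_lt hj).eq_or_lt with h1 | h1
      · subst h1; simp [dropVal, hh]
      · simp [dropVal, hj, show j + 1 < i from h1]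
    · simp only [Finset.sum_range_one, add_zero, hh, nndist_self, hK1.2.2, NNReal.coe_zero, zero_add]
      refine Finset.sum_congr rfl fun j _ => ?_
      simp [dropVal, add_assoc, add_comm, add_left_comm]
  have e2 : ∑ j ∈ Finset.range (i + r + 1),
      pieceCost g (dropVal i h j) (dropNode i t j) (dropNode i t (j + 1)) =
      ∑ j ∈ Finset.range (i + r + 1 + 1), pieceCost g (h j) (t j) (t (j + 1)) := by
    rw [show i + r + 1 = i + (1 + r) by ring, show i + (1 + r) + 1 = i + (2 + r) by ring,
      Finset.sum_range_add, Finset.sum_range_add (n := 1), Finset.sum_range_add,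
      Finset.sum_range_add (n := 2)]
    congr 1
    · refine Finset.sum_congr rfl fun j hj => ?_
      have hj := Finset.mem_range.1 hj
      simp [dropVal, dropNode, hj, hj.le, Nat.succ_le_of_lt hj]
    congr 1
    · rw [Finset.sum_range_one, Finset.sum_range_succ, Finset.sum_range_one]
      simp only [add_zero, dropVal, dropNode, lt_irrefl, if_false, le_refl, if_true,
        show ¬ (i + 1 ≤ i) by omega, hh, pieceCost]
      exact (intervalIntegral.integral_add_adjacent_intervals (intervalIntegrable_sq hgm hgb _ _ _)
        (intervalIntegrable_sq hgm hgb _ _ _)).symm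
    · refine Finset.sum_congr rfl fun j _ => ?_
      simp only [dropVal, dropNode, show ¬ (i + (1 + j) < i) by omega,
        show ¬ (i + (1 + j) ≤ i) by omega, show ¬ (i + (1 + j) + 1 ≤ i) by omega, if_false,
        show i + (2 + j) = i + (1 + j) + 1 by ring]
  rw [energy, energy, e1, e2]

/-- The effect on the energy of changing the value on an inner piece. -/
lemma energy_update (k : ℕ) (hk : k + 1 < n) (v : ℝ) :
    energy lam K g n t (Function.update h (k + 1) v) - energy lam K g n t h =
      (K (nndist (h k) v) + K (nndist v (h (k + 2))) - K (nndist (h k) (h (k + 1)))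
        - K (nndist (h (k + 1)) (h (k + 2))) : ℝ) +
      lam / 2 * (pieceCost g v (t (k + 1)) (t (k + 2)) -
        pieceCost g (h (k + 1)) (t (k + 1)) (t (k + 2))) := by
  obtain ⟨r, rfl⟩ : ∃ r, n = k + (2 + r) := ⟨n - (k + 2), by omega⟩
  set h' := Function.update h (k + 1) v with hh'
  have hne : ∀ j, j ≠ k + 1 → h' j = h j := fun j hj => Function.update_of_ne hj _ _
  have heq : h' (k + 1) = v := Function.update_self _ _ _
  have e1 : ∀ f : ℕ → ℝ, ∑ j ∈ Finset.range (k + (2 + r)), (K (nndist (f j) (f (j + 1))) : ℝ) =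
      ∑ j ∈ Finset.range k, (K (nndist (f j) (f (j + 1))) : ℝ) +
      (K (nndist (f k) (f (k + 1))) + K (nndist (f (k + 1)) (f (k + 2))) +
      ∑ j ∈ Finset.range r, (K (nndist (f (k + (2 + j))) (f (k + (2 + j) + 1))) : ℝ)) := by
    intro f
    rw [Finset.sum_range_add, Finset.sum_range_add (n := 2), Finset.sum_range_succ,
      Finset.sum_range_one]
    rfl
  have e2 : ∀ f : ℕ → ℝ, ∑ j ∈ Finset.range (k + (2 + r) + 1), pieceCost g (f j) (t j) (t (j + 1)) =
      ∑ j ∈ Finset.range (k + 1), pieceCost g (f j) (t j) (t (j + 1)) +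
      (pieceCost g (f (k + 1)) (t (k + 1)) (t (k + 2)) +
      ∑ j ∈ Finset.range (r + 1),
        pieceCost g (f (k + 1 + (1 + j))) (t (k + 1 + (1 + j))) (t (k + 1 + (1 + j) + 1))) := by
    intro f
    rw [show k + (2 + r) + 1 = (k + 1) + (1 + (r + 1)) by ring, Finset.sum_range_add,
      Finset.sum_range_add (n := 1), Finset.sum_range_one]
  have s1 : ∑ j ∈ Finset.range k, (K (nndist (h' j) (h' (j + 1))) : ℝ) =
      ∑ j ∈ Finset.range k, (K (nndist (h j) (h (j + 1))) : ℝ) :=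
    Finset.sum_congr rfl fun j hj => by
      have := Finset.mem_range.1 hj
      rw [hne j (by omega), hne (j + 1) (by omega)]
  have s2 : ∑ j ∈ Finset.range r, (K (nndist (h' (k + (2 + j))) (h' (k + (2 + j) + 1))) : ℝ) =
      ∑ j ∈ Finset.range r, (K (nndist (h (k + (2 + j))) (h (k + (2 + j) + 1))) : ℝ) :=
    Finset.sum_congr rfl fun j _ => by rw [hne _ (by omega), hne _ (by omega)]
  have s3 : ∑ j ∈ Finset.range (k + 1), pieceCost g (h' j) (t j) (t (j + 1)) =
      ∑ j ∈ Finset.range (k + 1), pieceCost g (h j) (t j) (t (j + 1)) :=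
    Finset.sum_congr rfl fun j hj => by
      have := Finset.mem_range.1 hj
      rw [hne j (by omega)]
  have s4 : ∑ j ∈ Finset.range (r + 1),
        pieceCost g (h' (k + 1 + (1 + j))) (t (k + 1 + (1 + j))) (t (k + 1 + (1 + j) + 1)) =
      ∑ j ∈ Finset.range (r + 1),
        pieceCost g (h (k + 1 + (1 + j))) (t (k + 1 + (1 + j))) (t (k + 1 + (1 + j) + 1)) :=
    Finset.sum_congr rfl fun j _ => by rw [hne _ (by omega)]
  simp only [energy, e1, e2, s1, s2, s3, s4, heq, hne k (by omega), hne (k + 2) (by omega)]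
  ring

/-- If neither neighbouring value improves on the value on an inner piece, the piece is long. -/
lemma min_le_mul_length {p q r l G : ℝ} {M C c : ℝ≥0} (hK1 : CondK1 K) (hlam : 0 < lam)
    (hM : 0 < M) (hMlo : hi - lo ≤ M) (hC : IsK2Const K M C) (hc : IsLowerConst K M c)
    (hp : p ∈ Icc lo hi) (hq : q ∈ Icc lo hi) (hr : r ∈ Icc lo hi) (hl : 0 ≤ l)
    (hG : G ∈ Icc (lo * l) (hi * l)) (hpq : p ≠ q) (hqr : q ≠ r)
    (h1 : (K (nndist p q) + K (nndist q r) : ℝ) ≤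
      K (nndist p r) + lam / 2 * ((p ^ 2 - q ^ 2) * l - 2 * (p - q) * G))
    (h2 : (K (nndist p q) + K (nndist q r) : ℝ) ≤
      K (nndist p r) + lam / 2 * ((r ^ 2 - q ^ 2) * l - 2 * (r - q) * G)) :
    min ((c : ℝ) / M) C ≤ lam * l := by
  have hM' : (0 : ℝ) < M := hM
  by_cases hbt : (p < q ∧ q < r) ∨ (r < q ∧ q < p)
  -- Monotone case: by (K2) the jump at `q` costs at least `C * |p - q| * |q - r|` more than a
  -- direct jump from `p` to `r`. Dividing each of the two comparisons by its own factor and adding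
  -- them cancels `G`.
  · refine (min_le_right _ _).trans ?_
    have hadd : nndist p r = nndist p q + nndist q r := by
      apply NNReal.coe_injective
      push_cast
      rw [Real.dist_eq, Real.dist_eq, Real.dist_eq]
      rcases hbt with ⟨h3, h4⟩ | ⟨h3, h4⟩
      · rw [abs_of_neg (by linarith), abs_of_neg (by linarith), abs_of_neg (by linarith)]; ring
      · rw [abs_of_pos (by linarith), abs_of_pos (by linarith), abs_of_pos (by linarith)]; ring
    have hle : nndist p q + nndist q r ≤ M := by
      rw [← hadd, ← NNReal.coe_le_coe, coe_nndist, Real.dist_eq]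
      refine le_trans ?_ hMlo
      exact abs_sub_le_of_le_of_le hp.1 hp.2 hr.1 hr.2
    have h5 := hC.2 _ _ hle
    rw [← hadd] at h5
    have h6 : (K (nndist p r) : ℝ) + C * nndist p q * nndist q r ≤
      K (nndist p q) + K (nndist q r) := mod_cast h5
    rw [coe_nndist, coe_nndist, Real.dist_eq, Real.dist_eq] at h6
    rcases hbt with ⟨h3, h4⟩ | ⟨h3, h4⟩
    · rw [abs_of_neg (by linarith), abs_of_neg (by linarith)] at h6
      have h7 : C * (r - q) ≤ lam / 2 * (2 * G - (p + q) * l) := by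
        refine le_of_mul_le_mul_left ?_ (sub_pos.2 h3); linarith
      have h8 : C * (q - p) ≤ lam / 2 * ((r + q) * l - 2 * G) := by
        refine le_of_mul_le_mul_left ?_ (sub_pos.2 h4); linarith
      have h9 : (C : ℝ) ≤ lam / 2 * l := by
        refine le_of_mul_le_mul_right ?_ (sub_pos.2 (h3.trans h4)); linarith
      nlinarith
    · rw [abs_of_pos (by linarith), abs_of_pos (by linarith)] at h6
      have h7 : C * (q - r) ≤ lam / 2 * ((p + q) * l - 2 * G) := by
        refine le_of_mul_le_mul_left ?_ (sub_pos.2 h4); linarith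
      have h8 : C * (p - q) ≤ lam / 2 * (2 * G - (r + q) * l) := by
        refine le_of_mul_le_mul_left ?_ (sub_pos.2 h3); linarith
      have h9 : (C : ℝ) ≤ lam / 2 * l := by
        refine le_of_mul_le_mul_right ?_ (sub_pos.2 (h3.trans h4)); linarith
      nlinarith
  -- Here `q` is a strict local extremum. Moving it to the nearer neighbour `v` saves at least `K
  -- (nndist v q) ≥ c * |v - q|`, while the fidelity grows by at most `lam * M * l * |v - q|`.
  · refine (min_le_left _ _).trans ?_
    have key : ∀ v, v ∈ Icc lo hi → v ≠ q →
        (K (nndist v q) : ℝ) ≤ lam / 2 * ((v ^ 2 - q ^ 2) * l - 2 * (v - q) * G) →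
        (c : ℝ) / M ≤ lam * l := by
      intro v hv hvq hle
      have hd : nndist v q ≤ M := by
        rw [← NNReal.coe_le_coe, coe_nndist, Real.dist_eq]
        exact (abs_sub_le_of_le_of_le hv.1 hv.2 hq.1 hq.2).trans hMlo
      have h3 : (c : ℝ) * |v - q| ≤ K (nndist v q) := by
        have := hc.2 _ hd
        rw [← Real.dist_eq, ← coe_nndist]
        exact_mod_cast this
      have hpos : 0 < |v - q| := abs_pos.2 (sub_ne_zero.2 hvq)
      have h4 : (v ^ 2 - q ^ 2) * l - 2 * (v - q) * G ≤ |v - q| * (2 * M * l) := by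
        have : (v ^ 2 - q ^ 2) * l - 2 * (v - q) * G = (v - q) * ((v + q) * l - 2 * G) := by ring
        rw [this]
        refine (le_abs_self _).trans ?_
        rw [abs_mul]
        refine mul_le_mul_of_nonneg_left ?_ (abs_nonneg _)
        have h5 : (hi - lo) * l ≤ M * l := mul_le_mul_of_nonneg_right hMlo hl
        have h6 : (lo + lo) * l ≤ (v + q) * l :=
          mul_le_mul_of_nonneg_right (by linarith [hv.1, hq.1]) hl
        have h7 : (v + q) * l ≤ (hi + hi) * l :=
          mul_le_mul_of_nonneg_right (by linarith [hv.2, hq.2]) hl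
        rw [abs_le]
        constructor <;> linarith [hG.1, hG.2]
      have h5 : (c : ℝ) ≤ lam * l * M := by
        refine le_of_mul_le_mul_right ?_ hpos
        have := mul_le_mul_of_nonneg_left h4 (half_pos hlam).le
        linarith
      rwa [div_le_iff₀ hM']
    have hsame : (p < q ∧ r < q) ∨ (q < p ∧ q < r) := by
      rcases lt_or_gt_of_ne hpq with h | h <;> rcases lt_or_gt_of_ne hqr with h' | h'
      · exact absurd (Or.inl ⟨h, h'⟩) hbt
      · exact Or.inl ⟨h, h'⟩
      · exact Or.inr ⟨h, h'⟩
      · exact absurd (Or.inr ⟨h', h⟩) hbt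
    rcases le_total |p - q| |r - q| with hle | hle
    -- Both neighbours lie on the same side of `q`, so their mutual distance is at most the distance
    -- from `q` to the farther one.
    · have h3 : (K (nndist p r) : ℝ) ≤ K (nndist q r) := by
        refine NNReal.coe_le_coe.2 (hK1.2.1 ?_)
        rw [← NNReal.coe_le_coe, coe_nndist, coe_nndist, Real.dist_eq, Real.dist_eq]
        rcases hsame with ⟨h, h'⟩ | ⟨h, h'⟩
        · rw [abs_of_neg (sub_neg.2 h), abs_of_neg (sub_neg.2 h')] at hle
          rw [abs_of_pos (sub_pos.2 h'), abs_of_nonneg] <;> linarith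
        · rw [abs_of_pos (sub_pos.2 h), abs_of_pos (sub_pos.2 h')] at hle
          rw [abs_of_neg (sub_neg.2 h'), abs_of_nonpos] <;> linarith
      exact key p hp hpq (by linarith)
    · have h3 : (K (nndist p r) : ℝ) ≤ K (nndist p q) := by
        refine NNReal.coe_le_coe.2 (hK1.2.1 ?_)
        rw [← NNReal.coe_le_coe, coe_nndist, coe_nndist, Real.dist_eq, Real.dist_eq]
        rcases hsame with ⟨h, h'⟩ | ⟨h, h'⟩
        · rw [abs_of_neg (sub_neg.2 h), abs_of_neg (sub_neg.2 h')] at hle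
          rw [abs_of_neg (sub_neg.2 h), abs_of_nonpos] <;> linarith
        · rw [abs_of_pos (sub_pos.2 h), abs_of_pos (sub_pos.2 h')] at hle
          rw [abs_of_pos (sub_pos.2 h), abs_of_nonneg] <;> linarith
      refine key r hr hqr.symm ?_
      rw [nndist_comm r q]
      linarith

/-- If no inner piece can be merged into a neighbour with a decrease of the energy, every inner
piece is long. -/
lemma min_le_mul_sub {M C c : ℝ≥0} (hK1 : CondK1 K) (hlam : 0 < lam)
    (hM : 0 < M) (hMlo : hi - lo ≤ M) (hC : IsK2Const K M C) (hc : IsLowerConst K M c)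
    (hgm : Measurable g) (hgb : ∀ x, g x ∈ Icc lo hi) (ht : Monotone t)
    {k : ℕ} (hk : k + 1 < n) (hh : ∀ j ≤ n, h j ∈ Icc lo hi)
    (h1 : energy lam K g n t h ≤ energy lam K g n t (Function.update h (k + 1) (h k)))
    (h2 : energy lam K g n t h ≤ energy lam K g n t (Function.update h (k + 1) (h (k + 2))))
    (hne1 : h k ≠ h (k + 1)) (hne2 : h (k + 1) ≠ h (k + 2)) :
    min ((c : ℝ) / M) C ≤ lam * (t (k + 2) - t (k + 1)) := by
  have hl : t (k + 1) ≤ t (k + 2) := ht (by omega)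
  have hgi := intervalIntegrable_of_mem_Icc hgm hgb (t (k + 1)) (t (k + 2))
  have e1 := energy_update (lam := lam) (K := K) (g := g) (t := t) (h := h) k hk (h k)
  have e2 := energy_update (lam := lam) (K := K) (g := g) (t := t) (h := h) k hk (h (k + 2))
  simp only [pieceCost_eq hgm hgb, nndist_self, hK1.2.2, NNReal.coe_zero] at e1 e2
  refine min_le_mul_length (G := ∫ x in (t (k + 1))..(t (k + 2)), g x) hK1 hlam hM hMlo hC hc
    (hh k (by omega)) (hh (k + 1) (by omega)) (hh (k + 2) (by omega)) (sub_nonneg.2 hl) ⟨?_, ?_⟩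
    hne1 hne2 ?_ ?_
  · have := intervalIntegral.integral_mono_on hl (intervalIntegrable_const (c := lo)) hgi
      fun x _ => (hgb x).1
    rw [intervalIntegral.integral_const, smul_eq_mul] at this
    linarith
  · have := intervalIntegral.integral_mono_on hl hgi (intervalIntegrable_const (c := hi))
      fun x _ => (hgb x).2
    rw [intervalIntegral.integral_const, smul_eq_mul] at this
    linarith
  · linarith
  · linarith

end Energy

end KWC

namespace KWC

/-! ### Minimization over step functions -/

section Minimization

variable {lam : ℝ} {K : ℝ≥0 → ℝ≥0} {g : ℝ → ℝ} {a b lo hi : ℝ} {n : ℕ} {t h : ℕ → ℝ}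

/-- Of the `n + 1` pieces only the `n - 1` inner ones are known to be long; they fit into `(a, b)`,
and the two outer ones account for the `+ 1`. -/
lemma le_floor_of_long_pieces {A : ℝ} (hA : 0 < A) (hlam : 0 < lam) (ht : IsPartition a b n t)
    (hlong : ∀ k, k + 1 < n → A ≤ lam * (t (k + 2) - t (k + 1))) :
    n ≤ ⌊(b - a) * lam / A⌋₊ + 1 := by
  rcases n with _ | m
  · omega
  refine Nat.succ_le_succ (Nat.le_floor ?_)
  rw [le_div_iff₀ hA]
  have h1 : ∑ k ∈ Finset.range m, A ≤
      ∑ k ∈ Finset.range m, lam * (t (k + 1 + 1) - t (k + 1)) :=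
    Finset.sum_le_sum fun k hk => hlong k (Nat.succ_lt_succ (Finset.mem_range.1 hk))
  rw [← Finset.mul_sum, Finset.sum_range_sub (fun k => t (k + 1)), Finset.sum_const,
    Finset.card_range, nsmul_eq_mul] at h1
  have h2 : t (m + 1) ≤ b := ht.eq_right (m + 2) le_rfl ▸ ht.mono (by omega)
  have h3 : a ≤ t 1 := ht.zero ▸ ht.mono (by omega)
  nlinarith

/-- The data entering the bound on the number of jumps. -/
structure IsJumpBound (K : ℝ≥0 → ℝ≥0) (lo hi : ℝ) (M C c : ℝ≥0) : Prop where
  pos : 0 < M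
  sub_le : hi - lo ≤ M
  isK2Const : IsK2Const K M C
  isLowerConst : IsLowerConst K M c

lemma IsJumpBound.min_pos {M C c : ℝ≥0} (hJ : IsJumpBound K lo hi M C c) :
    0 < min ((c : ℝ) / M) C :=
  lt_min (div_pos (NNReal.coe_pos.2 hJ.isLowerConst.1) (NNReal.coe_pos.2 hJ.pos))
    (NNReal.coe_pos.2 hJ.isK2Const.1)

/-- A step function with too many jumps can be simplified without increasing the energy. -/
lemma exists_energy_le_of_lt {M C c : ℝ≥0} (hK1 : CondK1 K) (hlam : 0 < lam)
    (hJ : IsJumpBound K lo hi M C c) (hgm : Measurable g) (hgb : ∀ x, g x ∈ Icc lo hi)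
    (ht : IsPartition a b (n + 1) t) (hh : ∀ j, h j ∈ Icc lo hi)
    (hn : ⌊(b - a) * lam / min ((c : ℝ) / M) C⌋₊ + 1 < n + 1) :
    ∃ t' h', IsPartition a b n t' ∧ (∀ j, h' j ∈ Icc lo hi) ∧
      energy lam K g n t' h' ≤ energy lam K g (n + 1) t h := by
  have main : ∃ i ≤ n, ∃ h', (∀ j, h' j ∈ Icc lo hi) ∧ h' i = h' (i + 1) ∧
      energy lam K g (n + 1) t h' ≤ energy lam K g (n + 1) t h := by
    -- If every choice of values with two equal neighbours had strictly larger energy, `h` itself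
    -- would have distinct neighbours and no merge would pay, so all inner pieces would be long and
    -- the count would contradict `hn`.
    by_contra hcon
    push Not at hcon
    refine absurd (le_floor_of_long_pieces hJ.min_pos hlam ht fun k hk => ?_) (not_le.2 hn)
    have hupd : ∀ v ∈ Icc lo hi, ∀ j, Function.update h (k + 1) v j ∈ Icc lo hi := by
      intro v hv j
      rcases eq_or_ne j (k + 1) with rfl | hj
      · rwa [Function.update_self]
      · rw [Function.update_of_ne hj]; exact hh j
    refine min_le_mul_sub hK1 hlam hJ.pos hJ.sub_le hJ.isK2Const hJ.isLowerConst hgm hgb ht.mono hk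
      (fun j _ => hh j) ?_ ?_ ?_ ?_
    · refine (hcon k (by omega) _ (hupd _ (hh k)) ?_).le
      rw [Function.update_self, Function.update_of_ne (by omega)]
    · refine (hcon (k + 1) (by omega) _ (hupd _ (hh (k + 2))) ?_).le
      rw [Function.update_self, Function.update_of_ne (by omega)]
    · exact fun h' => lt_irrefl _ (hcon k (by omega) h hh h')
    · exact fun h' => lt_irrefl _ (hcon (k + 1) (by omega) h hh h')
  obtain ⟨i, hi, h', hh', heq, hle⟩ := main
  refine ⟨dropNode i t, dropVal i h', ht.dropNode (Or.inl hi), fun j => ?_, ?_⟩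
  · unfold dropVal; split_ifs <;> exact hh' _
  · rwa [energy_drop hK1 hgm hgb hi heq]

lemma energy_succ_pad (hK1 : CondK1 K) (ht : IsPartition a b n t) (hh : h (n + 1) = h n) :
    energy lam K g (n + 1) t h = energy lam K g n t h := by
  rw [energy, energy, Finset.sum_range_succ, Finset.sum_range_succ _ (n + 1), hh, nndist_self,
    hK1.2.2, ht.eq_right (n + 1) le_rfl, ht.eq_right (n + 1 + 1) (by omega)]
  simp [pieceCost]

lemma energy_congr {h' : ℕ → ℝ} (hh : ∀ j ≤ n, h j = h' j) :
    energy lam K g n t h = energy lam K g n t h' := by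
  rw [energy, energy]
  congr 1
  · refine Finset.sum_congr rfl fun j hj => ?_
    have := Finset.mem_range.1 hj
    rw [hh j (by omega), hh (j + 1) (by omega)]
  · congr 1
    refine Finset.sum_congr rfl fun j hj => ?_
    have := Finset.mem_range.1 hj
    rw [hh j (by omega)]

/-- Padding with degenerate pieces at `b` that repeat the last value costs nothing, so "at most `N`
jumps" can be treated as a fixed number of nodes. -/
lemma exists_energy_eq_of_le (hK1 : CondK1 K) {N : ℕ} (hnN : n ≤ N) (ht : IsPartition a b n t)
    (hh : ∀ j, h j ∈ Icc lo hi) :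
    ∃ t' h', IsPartition a b N t' ∧ (∀ j, h' j ∈ Icc lo hi) ∧
      energy lam K g N t' h' = energy lam K g n t h := by
  induction N, hnN using Nat.le_induction with
  | base => exact ⟨t, h, ht, hh, rfl⟩
  | succ N _ ih =>
    obtain ⟨t', h', ht', hh', he⟩ := ih
    refine ⟨t', Function.update h' (N + 1) (h' N), ⟨ht'.mono, ht'.zero, fun j hj =>
      ht'.eq_right j (by omega)⟩, fun j => ?_, ?_⟩
    · rcases eq_or_ne j (N + 1) with rfl | hj
      · rw [Function.update_self]; exact hh' N
      · rw [Function.update_of_ne hj]; exact hh' j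
    · rw [energy_succ_pad hK1 ht' (by simp), ← he]
      exact energy_congr fun j hj => Function.update_of_ne (by omega) _ _

lemma exists_energy_le {M C c : ℝ≥0} (hK1 : CondK1 K) (hlam : 0 < lam)
    (hJ : IsJumpBound K lo hi M C c) (hgm : Measurable g) (hgb : ∀ x, g x ∈ Icc lo hi)
    (ht : IsPartition a b n t) (hh : ∀ j, h j ∈ Icc lo hi) :
    ∃ t' h', IsPartition a b (⌊(b - a) * lam / min ((c : ℝ) / M) C⌋₊ + 1) t' ∧
      (∀ j, h' j ∈ Icc lo hi) ∧
      energy lam K g (⌊(b - a) * lam / min ((c : ℝ) / M) C⌋₊ + 1) t' h' ≤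
        energy lam K g n t h := by
  induction n generalizing t h with
  | zero =>
    obtain ⟨t', h', h1, h2, h3⟩ := exists_energy_eq_of_le (lam := lam) (g := g) hK1
      (Nat.zero_le (⌊(b - a) * lam / min ((c : ℝ) / M) C⌋₊ + 1)) ht hh
    exact ⟨t', h', h1, h2, h3.le⟩
  | succ m ih =>
    rcases le_or_gt (m + 1) (⌊(b - a) * lam / min ((c : ℝ) / M) C⌋₊ + 1) with hle | hlt
    · obtain ⟨t', h', h1, h2, h3⟩ := exists_energy_eq_of_le (lam := lam) (g := g) hK1 hle ht hh
      exact ⟨t', h', h1, h2, h3.le⟩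
    · obtain ⟨t₁, h₁, h1, h2, h3⟩ := exists_energy_le_of_lt hK1 hlam hJ hgm hgb ht hh hlt
      obtain ⟨t', h', h4, h5, h6⟩ := ih h1 h2
      exact ⟨t', h', h4, h5, h6.trans h3⟩

lemma continuous_energy (hKc : Continuous K) (hgm : Measurable g) (hgb : ∀ x, g x ∈ Icc lo hi) :
    Continuous fun p : (ℕ → ℝ) × (ℕ → ℝ) => energy lam K g n p.1 p.2 := by
  have hprim : ∀ f : ℝ → ℝ, (∀ r s, IntervalIntegrable f volume r s) →
      ∀ i, Continuous fun p : (ℕ → ℝ) × (ℕ → ℝ) => ∫ x in (p.1 i)..(p.1 (i + 1)), f x := by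
    intro f hf i
    have h1 : Continuous fun x => ∫ y in (0 : ℝ)..x, f y := intervalIntegral.continuous_primitive hf 0
    have h2 : (fun p : (ℕ → ℝ) × (ℕ → ℝ) => ∫ x in (p.1 i)..(p.1 (i + 1)), f x) =
        fun p => (∫ y in (0 : ℝ)..(p.1 (i + 1)), f y) - ∫ y in (0 : ℝ)..(p.1 i), f y := by
      ext p
      rw [intervalIntegral.integral_interval_sub_left (hf _ _) (hf _ _)]
    rw [h2]
    exact (h1.comp (by fun_prop)).sub (h1.comp (by fun_prop))
  have h1 := hprim g (intervalIntegrable_of_mem_Icc hgm hgb)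
  have h2 := hprim (fun x => (0 - g x) ^ 2) (intervalIntegrable_sq hgm hgb 0)
  simp only [energy, pieceCost_eq hgm hgb]
  refine Continuous.add (continuous_finsetSum _ fun i _ => ?_)
    (continuous_const.mul (continuous_finsetSum _ fun i _ => ?_))
  · exact NNReal.continuous_coe.comp (hKc.comp (by fun_prop))
  · exact (Continuous.sub (by fun_prop) (Continuous.mul (by fun_prop) (h1 i))).add (h2 i)

lemma IsPartition.mem_Icc (ht : IsPartition a b n t) (j : ℕ) : t j ∈ Icc a b :=
  ⟨ht.zero ▸ ht.mono (Nat.zero_le j),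
    ht.eq_right (max j (n + 1)) (le_max_right _ _) ▸ ht.mono (le_max_left _ _)⟩

/-- Tychonoff in the space of sequences; coinciding nodes are allowed precisely so that the set is
closed. -/
lemma isCompact_partition : IsCompact {t | IsPartition a b n t} := by
  refine (isCompact_univ_pi fun _ : ℕ => isCompact_Icc (a := a) (b := b)).of_isClosed_subset ?_
    fun t ht j _ => ht.mem_Icc j
  have : {t | IsPartition a b n t} =
      {t | Monotone t} ∩ ({t | t 0 = a} ∩ ⋂ j, {t | n + 1 ≤ j → t j = b}) := by
    ext t
    simp only [mem_ofPred_eq, mem_inter_iff, mem_iInter]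
    exact ⟨fun h => ⟨h.1, h.2, h.3⟩, fun h => ⟨h.1, h.2.1, h.2.2⟩⟩
  rw [this]
  refine isClosed_monotone.inter ((isClosed_eq (by fun_prop) (by fun_prop)).inter
    (isClosed_iInter fun j => ?_))
  by_cases hj : n + 1 ≤ j
  · simp only [hj, true_imp_iff]
    exact isClosed_eq (by fun_prop) (by fun_prop)
  · simp [hj]

/-- Among step functions with values in `[lo, hi]` and at most `n` jumps, one has least energy. -/
lemma exists_energy_min (hKc : Continuous K) (hab : a ≤ b) (hlohi : lo ≤ hi) (hgm : Measurable g)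
    (hgb : ∀ x, g x ∈ Icc lo hi) (n : ℕ) :
    ∃ t h, IsPartition a b n t ∧ (∀ j, h j ∈ Icc lo hi) ∧
      ∀ t' h', IsPartition a b n t' → (∀ j, h' j ∈ Icc lo hi) →
        energy lam K g n t h ≤ energy lam K g n t' h' := by
  have hc : IsCompact ({t | IsPartition a b n t} ×ˢ {h : ℕ → ℝ | ∀ j, h j ∈ Icc lo hi}) := by
    refine isCompact_partition.prod ?_
    have := isCompact_univ_pi fun _ : ℕ => isCompact_Icc (a := lo) (b := hi)
    simpa [Set.pi] using this
  have hne : ({t | IsPartition a b n t} ×ˢ {h : ℕ → ℝ | ∀ j, h j ∈ Icc lo hi}).Nonempty := by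
    refine ⟨(fun j => if j = 0 then a else b, fun _ => lo), ⟨?_, rfl, ?_⟩, fun _ => ⟨le_rfl, hlohi⟩⟩
    · refine monotone_nat_of_le_succ fun j => ?_
      rcases eq_or_ne j 0 with rfl | hj
      · simpa using hab
      · simp [hj]
    · intro j hj
      exact if_neg (by omega)
  obtain ⟨⟨t, h⟩, ⟨ht, hh⟩, hmin⟩ := hc.exists_isMinOn hne
    (continuous_energy (lam := lam) hKc hgm hgb).continuousOn
  exact ⟨t, h, ht, hh, fun t' h' ht' hh' => hmin (a := (t', h')) ⟨ht', hh'⟩⟩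

/-- Truncation to the range of `g`. -/
def clamp (lo hi y : ℝ) : ℝ := max lo (min y hi)

lemma clamp_mem (hlohi : lo ≤ hi) (y : ℝ) : clamp lo hi y ∈ Icc lo hi :=
  ⟨le_max_left _ _, max_le hlohi (min_le_right _ _)⟩

lemma clamp_of_mem {y : ℝ} (hy : y ∈ Icc lo hi) : clamp lo hi y = y := by
  rw [clamp, min_eq_left hy.2, max_eq_right hy.1]

lemma nndist_clamp_le (x y : ℝ) : nndist (clamp lo hi x) (clamp lo hi y) ≤ nndist x y := by
  rw [← NNReal.coe_le_coe, coe_nndist, coe_nndist, Real.dist_eq, Real.dist_eq]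
  calc |max lo (min x hi) - max lo (min y hi)| ≤ |min x hi - min y hi| := by
        rw [max_comm lo, max_comm lo]; exact abs_max_sub_max_le_abs _ _ _
    _ ≤ max |x - y| |hi - hi| := abs_min_sub_min_le_max _ _ _ _
    _ = |x - y| := by simp

/-- Obtuse angle property of the projection onto an interval. The extra square makes the gain by
truncation strict. -/
lemma sq_clamp_sub_le {y z : ℝ} (hz : z ∈ Icc lo hi) :
    (clamp lo hi y - z) ^ 2 + (y - clamp lo hi y) ^ 2 ≤ (y - z) ^ 2 := by
  have : 0 ≤ (y - clamp lo hi y) * (clamp lo hi y - z) := by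
    rcases le_total y lo with h | h
    · rw [clamp, max_eq_left ((min_le_left _ _).trans h)]
      exact mul_nonneg_of_nonpos_of_nonpos (by linarith) (by linarith [hz.1])
    · rcases le_total y hi with h' | h'
      · rw [clamp_of_mem ⟨h, h'⟩]; simp
      · rw [clamp, min_eq_right h', max_eq_right (hz.1.trans hz.2)]
        exact mul_nonneg (by linarith) (by linarith [hz.2])
  nlinarith

/-- Truncating the values decreases the energy, strictly unless nothing is truncated. -/
lemma energy_clamp_add_le (hK1 : CondK1 K) (hlam : 0 < lam) (hgm : Measurable g)
    (hgb : ∀ x, g x ∈ Icc lo hi) (ht : Monotone t) :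
    energy lam K g n t (fun i => clamp lo hi (h i)) +
      lam / 2 * ∑ i ∈ Finset.range (n + 1), (h i - clamp lo hi (h i)) ^ 2 * (t (i + 1) - t i) ≤
      energy lam K g n t h := by
  rw [energy, energy, add_assoc, ← mul_add, ← Finset.sum_add_distrib]
  refine add_le_add (Finset.sum_le_sum fun i _ =>
    NNReal.coe_le_coe.2 (hK1.2.1 (nndist_clamp_le _ _)))
    (mul_le_mul_of_nonneg_left (Finset.sum_le_sum fun i _ => ?_) (half_pos hlam).le)
  have hle : t i ≤ t (i + 1) := ht (Nat.le_succ i)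
  have h1 := intervalIntegrable_sq hgm hgb (clamp lo hi (h i)) (t i) (t (i + 1))
  have h2 := intervalIntegrable_sq hgm hgb (h i) (t i) (t (i + 1))
  have h3 := intervalIntegral.integral_mono_on hle
    (h1.add (intervalIntegrable_const (c := (h i - clamp lo hi (h i)) ^ 2))) h2
    fun x _ => sq_clamp_sub_le (hgb x)
  rw [intervalIntegral.integral_add h1 intervalIntegrable_const, intervalIntegral.integral_const,
    smul_eq_mul] at h3
  rw [pieceCost, pieceCost]
  linarith

end Minimization

end KWC

namespace KWC

/-! ### The energy of a step function -/

section Link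

variable {lam : ℝ} {K : ℝ≥0 → ℝ≥0} {g u : ℝ → ℝ} {a b lo hi : ℝ} {n : ℕ} {t h : ℕ → ℝ}

lemma fidelity_congr {g' u' : ℝ → ℝ}
    (hg : ∀ᵐ x ∂volume.restrict (Ioo a b), g x = g' x)
    (hu : ∀ᵐ x ∂volume.restrict (Ioo a b), u x = u' x) :
    fidelity a b lam g u = fidelity a b lam g' u' := by
  rw [fidelity, fidelity]
  congr 1
  refine lintegral_congr_ae ?_
  filter_upwards [hg, hu] with x h1 h2
  rw [h1, h2]

lemma fidelity_eq_ofReal (hlam : 0 < lam)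
    (hi : IntegrableOn (fun x => (u x - g x) ^ 2) (Ioo a b)) :
    fidelity a b lam g u = ENNReal.ofReal (lam / 2 * ∫ x in Ioo a b, (u x - g x) ^ 2) := by
  rw [fidelity, ENNReal.ofReal_mul (half_pos hlam).le,
    ofReal_integral_eq_lintegral_ofReal hi (Eventually.of_forall fun x => sq_nonneg _)]
  congr 1
  refine lintegral_congr fun x => ?_
  rw [Real.enorm_eq_ofReal_abs, ← ENNReal.ofReal_pow (abs_nonneg _), sq_abs]

lemma IsStep.fidelity_eq (hab : a < b) (hlam : 0 < lam) (hgm : Measurable g)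
    (hgb : ∀ x, g x ∈ Icc lo hi) (ht : IsPartition a b n t) (hu : IsStep n t h u) :
    fidelity a b lam g u =
      ENNReal.ofReal (lam / 2 * ∑ i ∈ Finset.range (n + 1), pieceCost g (h i) (t i) (t (i + 1))) := by
  set w := stepFun n t h
  set B := |h 0| + ∑ i ∈ Finset.range n, |h (i + 1) - h i|
  have hint : ∀ r s, IntervalIntegrable (fun x => (0 - (w x - g x)) ^ 2) volume r s :=
    intervalIntegrable_sq (lo := -B - hi) (hi := B - lo) (measurable_stepFun.sub hgm) (fun x => by
      have h1 := abs_le.1 (abs_stepFun_le n t h x)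
      change stepFun n t h x - g x ∈ _
      exact ⟨by linarith [(hgb x).2, h1.1], by linarith [(hgb x).1, h1.2]⟩) 0
  simp only [zero_sub, neg_sq] at hint
  rw [fidelity_congr (g' := g) (Eventually.of_forall fun _ => rfl) (hu.ae_eq_stepFun ht),
    fidelity_eq_ofReal hlam]
  · congr 2
    rw [← integral_Ioc_eq_integral_Ioo, ← intervalIntegral.integral_of_le hab.le]
    have := intervalIntegral.sum_integral_adjacent_intervals (a := t) (n := n + 1)
      (f := fun x => (w x - g x) ^ 2) (μ := volume) fun k _ => hint _ _
    rw [ht.zero, ht.eq_right (n + 1) le_rfl] at this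
    rw [← this]
    refine Finset.sum_congr rfl fun i hi => ?_
    have hle : t i ≤ t (i + 1) := ht.mono (Nat.le_succ i)
    rw [pieceCost, intervalIntegral.integral_of_le hle, intervalIntegral.integral_of_le hle,
      integral_Ioc_eq_integral_Ioo, integral_Ioc_eq_integral_Ioo]
    refine setIntegral_congr_fun measurableSet_Ioo fun x hx => ?_
    simp only [w]
    rw [stepFun_eq ht.mono (Nat.lt_succ_iff.1 (Finset.mem_range.1 hi)) ⟨hx.1.le, hx.2⟩]
  · exact ((intervalIntegrable_iff_integrableOn_Ioc_of_le hab.le).1 (hint a b)).mono_set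
      Ioo_subset_Ioc_self

lemma pieceCost_nonneg {v r s : ℝ} (hrs : r ≤ s) : 0 ≤ pieceCost g v r s :=
  intervalIntegral.integral_nonneg hrs fun _ _ => sq_nonneg _

lemma fidelity_part_nonneg (hlam : 0 < lam) (ht : Monotone t) :
    0 ≤ lam / 2 * ∑ i ∈ Finset.range (n + 1), pieceCost g (h i) (t i) (t (i + 1)) :=
  mul_nonneg (half_pos hlam).le (Finset.sum_nonneg fun i _ => pieceCost_nonneg (ht (Nat.le_succ i)))

lemma energy_nonneg (hlam : 0 < lam) (ht : Monotone t) : 0 ≤ energy lam K g n t h :=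
  add_nonneg (Finset.sum_nonneg fun _ _ => NNReal.coe_nonneg _) (fidelity_part_nonneg hlam ht)

lemma IsStep.ofReal_energy (hab : a < b) (hlam : 0 < lam) (hgm : Measurable g)
    (hgb : ∀ x, g x ∈ Icc lo hi) (ht : IsPartition a b n t) (hu : IsStep n t h u) :
    ENNReal.ofReal (energy lam K g n t h) =
      ∑ i ∈ Finset.range n, (K (nndist (h i) (h (i + 1))) : ℝ≥0∞) + fidelity a b lam g u := by
  rw [hu.fidelity_eq hab hlam hgm hgb ht, energy, ENNReal.ofReal_add
    (Finset.sum_nonneg fun _ _ => NNReal.coe_nonneg _) (fidelity_part_nonneg hlam ht.mono),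
    ENNReal.ofReal_sum_of_nonneg fun _ _ => NNReal.coe_nonneg _]
  simp

lemma IsStep.TVKg_le (hK1 : CondK1 K) (hK2 : CondK2 K) (hab : a < b) (hlam : 0 < lam)
    (hgm : Measurable g) (hgb : ∀ x, g x ∈ Icc lo hi) (ht : IsPartition a b n t)
    (hu : IsStep n t h u) : TVKg a b lam K g u ≤ ENNReal.ofReal (energy lam K g n t h) := by
  rw [hu.ofReal_energy hab hlam hgm hgb ht, TVKg]
  exact add_le_add (hu.TVK_le hK1 hK2 hab ht) le_rfl

/-- Converse to `IsStep.TVKg_le` for nonempty pieces: sampling the primitive once inside each piece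
recovers all values `h i`. -/
lemma IsStep.le_TVKg (hK1 : CondK1 K) (hK2 : CondK2 K) (hK3 : CondK3 K) (hab : a < b)
    (hlam : 0 < lam) (hgm : Measurable g) (hgb : ∀ x, g x ∈ Icc lo hi) (ht : IsPartition a b n t)
    (hstrict : ∀ i ≤ n, t i < t (i + 1)) (hu : IsStep n t h u) :
    ENNReal.ofReal (energy lam K g n t h) ≤ TVKg a b lam K g u := by
  rw [hu.ofReal_energy hab hlam hgm hgb ht, TVKg]
  refine add_le_add ?_ le_rfl
  have hui := hu.integrableOn ht
  have hμ := hu.isDistribDeriv ht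
  obtain ⟨c, hc⟩ := hμ.ae_eq_primitive hui
  let s : ℕ → ℝ := fun i => (t i + t (i + 1)) / 2
  have hs : Monotone s := fun i j hij => by
    have h1 := ht.mono hij
    have h2 := ht.mono (Nat.succ_le_succ hij)
    simp only [s]
    simp only [Nat.succ_eq_add_one] at h2
    linarith
  have hsm : ∀ i ≤ n, s i ∈ Ioo (t i) (t (i + 1)) := fun i hi => by
    have := hstrict i hi
    constructor <;> simp only [s] <;> linarith
  have hsab : ∀ i ≤ n, s i ∈ Ioo a b := fun i hi =>
    ⟨(ht.mem_Icc i).1.trans_lt (hsm i hi).1, (hsm i hi).2.trans_le (ht.mem_Icc (i + 1)).2⟩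
  -- Near the midpoint `u` is a.e. `h i`, so both numbers are right traces of `u` there.
  have hval : ∀ i ≤ n, c + stepMeasure a b n t h (Ioc a (s i)) = h i := fun i hi =>
    (isRightTrace_of_ae_eq hc (hsab i hi)).unique hui (hsab i hi)
      (tendsto_average_abs_sub (F := fun _ => h i) (eventually_Ioo_right (hsm i hi)) (hu i hi)
        (fun ε hε => Eventually.of_forall fun r y _ => by simpa using hε.le)
        fun _ => measurableSet_Ioo)
  refine le_trans (le_of_eq (Finset.sum_congr rfl fun i hi => ?_))
    (sum_jumpCost_le_TVK hK1 hK2 hK3 hab hui hμ hs n)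
  have hi := Finset.mem_range.1 hi
  rw [nndist_comm, nndist_eq_nnnorm, ← hval i hi.le, ← hval (i + 1) hi,
    ← Ioc_union_Ioc_eq_Ioc (hsab i hi.le).1.le (hs (Nat.le_succ i)),
    VectorMeasure.of_union (Ioc_disjoint_Ioc_of_le le_rfl) measurableSet_Ioc measurableSet_Ioc,
    ← add_assoc, add_sub_cancel_left]

/-! ### Approximation by step functions -/

/-- The uniform division of `(a, b)` into `n + 1` pieces. -/
noncomputable def uniformNode (a b : ℝ) (n j : ℕ) : ℝ := min b (a + j * ((b - a) / (n + 1)))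

lemma isPartition_uniformNode (hab : a < b) (n : ℕ) : IsPartition a b n (uniformNode a b n) where
  mono i j hij := by
    have : 0 ≤ (b - a) / ((n : ℝ) + 1) := div_nonneg (by linarith) (by positivity)
    have h2 : (i : ℝ) ≤ j := mod_cast hij
    exact min_le_min le_rfl (add_le_add le_rfl (mul_le_mul_of_nonneg_right h2 this))
  zero := by simp [uniformNode, hab.le]
  eq_right j hj := by
    refine min_eq_left ?_
    have h1 : (n : ℝ) + 1 ≤ j := mod_cast hj
    have h2 : b - a ≤ j * ((b - a) / (n + 1)) := by
      rw [mul_div_assoc', le_div_iff₀ (by positivity), mul_comm]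
      exact mul_le_mul_of_nonneg_right h1 (by linarith)
    linarith

lemma uniformNode_succ_le (hab : a < b) (n j : ℕ) :
    uniformNode a b n (j + 1) ≤ uniformNode a b n j + (b - a) / (n + 1) := by
  have : 0 ≤ (b - a) / ((n : ℝ) + 1) := div_nonneg (by linarith) (by positivity)
  rw [uniformNode, uniformNode, ← min_add_add_right]
  refine min_le_min (by linarith) (le_of_eq ?_)
  push_cast; ring

/-- Step functions sampled from the primitive have jump cost at most `TVK u`, and their fidelity
tends to that of `u` by dominated convergence. It is not necessary that the jump costs converge. -/
lemma le_TVKg_of_le_energy (hK1 : CondK1 K) (hK2 : CondK2 K) (hK3 : CondK3 K) (hab : a < b)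
    (hlam : 0 < lam) (hgm : Measurable g) (hgb : ∀ x, g x ∈ Icc lo hi) {E : ℝ}
    (hE : ∀ n t h, IsPartition a b n t → E ≤ energy lam K g n t h) (hu : MemBV a b u) :
    ENNReal.ofReal E ≤ TVKg a b lam K g u := by
  obtain ⟨hui, μ, hμ⟩ := hu
  obtain ⟨c, hc⟩ := hμ.ae_eq_primitive hui
  let F : ℝ → ℝ := fun x => c + μ (Ioc a x)
  let t : ℕ → ℕ → ℝ := uniformNode a b
  -- Sampling at the right endpoint of each piece puts the sample point in `(x, x + (b - a) / (n +
  -- 1)]`, so right continuity gives convergence at every point, including the jumps.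
  let h : ℕ → ℕ → ℝ := fun n i => F (t n (i + 1))
  let w : ℕ → ℝ → ℝ := fun n => stepFun n (t n) (h n)
  have ht : ∀ n, IsPartition a b n (t n) := isPartition_uniformNode hab
  have hw : ∀ n : ℕ, ∀ x ∈ Ioo a b, ∃ y ∈ Ioc x (x + (b - a) / (n + 1)), w n x = F y := by
    intro n x hx
    obtain ⟨i, hi, hxi⟩ := (ht n).exists_piece ⟨hx.1.le, hx.2⟩
    refine ⟨t n (i + 1), ⟨hxi.2, (uniformNode_succ_le hab n i).trans ?_⟩,
      stepFun_eq (ht n).mono hi hxi⟩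
    exact add_le_add hxi.1 le_rfl
  have hlim : ∀ x ∈ Ioo a b, Tendsto (fun n => w n x) atTop (𝓝 (F x)) := by
    intro x hx
    rw [Metric.tendsto_nhds]
    intro ε hε
    have h1 : Tendsto (fun n : ℕ => (b - a) / ((n : ℝ) + 1)) atTop (𝓝[>] 0) := by
      refine tendsto_nhdsWithin_iff.2 ⟨?_, Eventually.of_forall fun n =>
        div_pos (sub_pos.2 hab) (by positivity)⟩
      simpa [div_eq_mul_inv] using
        (tendsto_one_div_add_atTop_nhds_zero_nat (𝕜 := ℝ)).const_mul (b - a)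
    filter_upwards [h1.eventually (eventually_abs_Ioc_sub_le_right μ hx.1.le (half_pos hε))]
      with n hn
    obtain ⟨y, hy, hwy⟩ := hw n x hx
    rw [hwy, Real.dist_eq, add_sub_add_left_eq_sub]
    exact (hn y hy).trans_lt (half_lt_self hε)
  have hF : ∀ x, |F x| ≤ |c| + μ.totalVariation.real univ := fun x =>
    (abs_add_le _ _).trans (add_le_add le_rfl ((μ.norm_le_totalVariation _).trans
      (measureReal_mono (subset_univ _))))
  have hfid : Tendsto (fun n => fidelity a b lam g (w n)) atTop (𝓝 (fidelity a b lam g F)) := by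
    refine ENNReal.Tendsto.const_mul ?_ (Or.inr ENNReal.ofReal_ne_top)
    refine tendsto_lintegral_of_dominated_convergence'
      (fun _ => ENNReal.ofReal (|c| + μ.totalVariation.real univ + max |lo| |hi|) ^ 2)
      (fun n => ((measurable_stepFun.sub hgm).enorm.pow_const 2).aemeasurable) (fun n => ?_) ?_ ?_
    · filter_upwards [ae_restrict_mem measurableSet_Ioo] with x hx
      obtain ⟨y, _, hy⟩ := hw n x hx
      rw [Real.enorm_eq_ofReal_abs, hy]
      refine pow_le_pow_left₀ zero_le (ENNReal.ofReal_le_ofReal ?_) 2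
      exact (abs_sub _ _).trans (add_le_add (hF y) (abs_le_max_abs_abs (hgb x).1 (hgb x).2))
    · rw [lintegral_const, Measure.restrict_apply_univ]
      exact ENNReal.mul_ne_top (ENNReal.pow_ne_top ENNReal.ofReal_ne_top) measure_Ioo_lt_top.ne
    · filter_upwards [ae_restrict_mem measurableSet_Ioo] with x hx
      have := ((hlim x hx).sub_const (g x)).enorm
      exact (ENNReal.continuous_pow 2).tendsto _ |>.comp this
  rw [TVKg, fidelity_congr (g' := g) (Eventually.of_forall fun _ => rfl) hc]
  refine ge_of_tendsto (hfid.const_add (TVK a b K u)) (Eventually.of_forall fun n => ?_)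
  refine (ENNReal.ofReal_le_ofReal (hE n (t n) (h n) (ht n))).trans ?_
  rw [(isStep_stepFun (ht n).mono).ofReal_energy hab hlam hgm hgb (ht n)]
  refine add_le_add ?_ le_rfl
  have hs : Monotone fun i => t n (i + 1) := fun i j hij => (ht n).mono (Nat.succ_le_succ hij)
  refine le_trans (le_of_eq (Finset.sum_congr rfl fun i _ => ?_))
    (sum_jumpCost_le_TVK hK1 hK2 hK3 hab hui hμ hs n)
  rw [nndist_comm, nndist_eq_nnnorm, add_sub_add_left_eq_sub,
    ← Ioc_union_Ioc_eq_Ioc ((ht n).mem_Icc (i + 1)).1 (hs (Nat.le_succ i)),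
    VectorMeasure.of_union (Ioc_disjoint_Ioc_of_le le_rfl) measurableSet_Ioc measurableSet_Ioc,
    add_sub_cancel_left]

/-! ### Representations of piecewise constant functions -/

lemma exists_isStep_of_isPiecewiseConstant (hab : a < b) (hu : IsPiecewiseConstant a b u) :
    ∃ n t h, IsPartition a b n t ∧ IsStep n t h u := by
  obtain ⟨m, t, h, hmono, h0, hl, hu⟩ := hu
  rcases m with _ | n
  · exact absurd (h0.symm.trans hl) hab.ne
  -- The finite families become sequences by repeating their last entries, so the nodes stay at `b`.
  refine ⟨n, fun j => t ⟨min j (n + 1), by omega⟩, fun j => h ⟨min j n, by omega⟩, ⟨?_, ?_, ?_⟩, ?_⟩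
  · intro i j hij
    exact hmono.monotone (Fin.mk_le_mk.2 (min_le_min hij le_rfl))
  · simpa using h0
  · intro j hj
    rw [← hl]
    congr 1
    exact Fin.ext (min_eq_right hj)
  · intro i hi
    have := hu ⟨i, by omega⟩
    simpa [Fin.castSucc, Fin.succ, Fin.castAdd, Fin.castLE, hi, (hi.trans (Nat.le_succ n)),
      Nat.succ_le_succ hi] using this

/-- A step function can be represented with nonempty pieces and distinct neighbouring values. -/
lemma IsStep.exists_reduced (hab : a < b) (ht : IsPartition a b n t) (hu : IsStep n t h u) :
    ∃ m t' h', IsPartition a b m t' ∧ IsStep m t' h' u ∧ (∀ i ≤ m, t' i < t' (i + 1)) ∧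
      ∀ i < m, h' i ≠ h' (i + 1) := by
  induction n generalizing t h with
  | zero =>
    refine ⟨0, t, h, ht, hu, fun i hi => ?_, fun i hi => absurd hi (Nat.not_lt_zero i)⟩
    obtain rfl : i = 0 := by omega
    rw [ht.zero, ht.eq_right 1 le_rfl]
    exact hab
  | succ n ih =>
    by_cases h1 : ∃ i ≤ n + 1, t i = t (i + 1)
    · obtain ⟨i, hi, he⟩ := h1
      -- An empty piece is deleted; below, equal neighbours are merged. Each lowers `n`, so the
      -- process stops.
      refine ih (ht.dropNode (i := i) ?_) (hu.drop (Or.inr he))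
      rcases Nat.le_succ_iff.1 hi with h | rfl
      · exact Or.inl h
      · exact Or.inr (he.trans (ht.eq_right _ le_rfl))
    by_cases h2 : ∃ i < n + 1, h i = h (i + 1)
    · obtain ⟨i, hi, he⟩ := h2
      have hi' : i ≤ n := Nat.lt_succ_iff.1 hi
      exact ih (ht.dropNode (Or.inl hi')) (hu.drop (Or.inl ⟨hi', he⟩))
    push Not at h1 h2
    exact ⟨n + 1, t, h, ht, hu, fun i hi => lt_of_le_of_ne (ht.mono (Nat.le_succ i)) (h1 i hi), h2⟩

lemma IsStep.isPiecewiseConstant (hab : a < b) (ht : IsPartition a b n t) (hu : IsStep n t h u) :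
    IsPiecewiseConstant a b u := by
  obtain ⟨m, t, h, ht, hu, hs, -⟩ := hu.exists_reduced hab ht
  refine ⟨m + 1, fun i => t i, fun i => h i, Fin.strictMono_iff_lt_succ.2 fun i => ?_, ht.zero,
    ht.eq_right _ le_rfl, fun i => ?_⟩
  · exact hs i (Nat.lt_succ_iff.1 i.2)
  · exact hu i (Nat.lt_succ_iff.1 i.2)

end Link

end KWC

namespace KWC

/-! ### Minimizers -/

section Minimizers

variable {lam : ℝ} {K : ℝ≥0 → ℝ≥0} {g U : ℝ → ℝ} {a b lo hi : ℝ} {n : ℕ} {t h : ℕ → ℝ}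

lemma isMinimizer_congr {g' : ℝ → ℝ} (hg : ∀ᵐ x ∂volume.restrict (Ioo a b), g x = g' x) :
    IsMinimizer a b lam K g U ↔ IsMinimizer a b lam K g' U := by
  have : ∀ v, TVKg a b lam K g v = TVKg a b lam K g' v := fun v => by
    rw [TVKg, TVKg, fidelity_congr hg (Eventually.of_forall fun _ => rfl)]
  simp only [IsMinimizer, this]

/-- Existence of a piecewise constant minimizer. -/
lemma exists_isMinimizer (hK1 : CondK1 K) (hK2 : CondK2 K) (hK3 : CondK3 K) (hab : a < b)
    (hlam : 0 < lam) (hgm : Measurable g) (hgb : ∀ x, g x ∈ Icc lo hi) :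
    ∃ U, IsMinimizer a b lam K g U ∧ IsPiecewiseConstant a b U := by
  have hlohi : lo ≤ hi := (hgb 0).1.trans (hgb 0).2
  obtain ⟨M, hM0, hM⟩ : ∃ M : ℝ≥0, 0 < M ∧ hi - lo ≤ M :=
    ⟨Real.toNNReal (hi - lo) + 1, by positivity,
      (Real.le_coe_toNNReal _).trans (by push_cast; linarith)⟩
  obtain ⟨C, hC⟩ := hK2 M hM0
  obtain ⟨c, hc⟩ := exists_isLowerConst hK1 hK3 hM0
  have hJ : IsJumpBound K lo hi M C c := ⟨hM0, hM, hC, hc⟩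
  obtain ⟨t, h, ht, hh, hmin⟩ := exists_energy_min (lam := lam)
    (continuous_of_conds hK1 hK2 hK3) hab.le hlohi hgm hgb
    (⌊(b - a) * lam / min ((c : ℝ) / M) C⌋₊ + 1)
  have hst := isStep_stepFun (h := h) (n := ⌊(b - a) * lam / min ((c : ℝ) / M) C⌋₊ + 1) ht.mono
  refine ⟨_, ⟨hst.memBV ht, fun v hv => ?_⟩, hst.isPiecewiseConstant hab ht⟩
  refine (hst.TVKg_le hK1 hK2 hab hlam hgm hgb ht).trans
    (le_TVKg_of_le_energy hK1 hK2 hK3 hab hlam hgm hgb (fun n t₁ h₁ ht₁ => ?_) hv)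
  obtain ⟨t', h', ht', hh', hle⟩ := exists_energy_le hK1 hlam hJ hgm hgb ht₁
    fun j => clamp_mem hlohi (h₁ j)
  refine (hmin t' h' ht' hh').trans (hle.trans (le_trans ?_
    (energy_clamp_add_le hK1 hlam hgm hgb ht₁.mono)))
  refine le_add_of_nonneg_right (mul_nonneg (half_pos hlam).le (Finset.sum_nonneg fun i _ => ?_))
  exact mul_nonneg (sq_nonneg _) (sub_nonneg.2 (ht₁.mono (Nat.le_succ i)))

/-- Sandwich: the reduced representation of `U` has energy at most `TVKg U`, and any competitor's
`TVKg` is at most its discrete energy, even with coinciding nodes. -/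
lemma IsMinimizer.energy_le (hK1 : CondK1 K) (hK2 : CondK2 K) (hK3 : CondK3 K) (hab : a < b)
    (hlam : 0 < lam) (hgm : Measurable g) (hgb : ∀ x, g x ∈ Icc lo hi)
    (hmin : IsMinimizer a b lam K g U) (ht : IsPartition a b n t) (hU : IsStep n t h U)
    (hstrict : ∀ i ≤ n, t i < t (i + 1)) {m : ℕ} {t' h' : ℕ → ℝ} (ht' : IsPartition a b m t') :
    energy lam K g n t h ≤ energy lam K g m t' h' := by
  have hst := isStep_stepFun (n := m) (h := h') ht'.mono
  have := (hU.le_TVKg hK1 hK2 hK3 hab hlam hgm hgb ht hstrict).trans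
    ((hmin.2 _ (hst.memBV ht')).trans (hst.TVKg_le hK1 hK2 hab hlam hgm hgb ht'))
  exact (ENNReal.ofReal_le_ofReal_iff (energy_nonneg hlam ht'.mono)).1 this

/-- The values of a minimizing step function lie in the range of the datum. -/
lemma IsMinimizer.value_mem (hK1 : CondK1 K) (hK2 : CondK2 K) (hK3 : CondK3 K) (hab : a < b)
    (hlam : 0 < lam) (hgm : Measurable g) (hgb : ∀ x, g x ∈ Icc lo hi)
    (hmin : IsMinimizer a b lam K g U) (ht : IsPartition a b n t) (hU : IsStep n t h U)
    (hstrict : ∀ i ≤ n, t i < t (i + 1)) {i : ℕ} (hi' : i ≤ n) : h i ∈ Icc lo hi := by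
  have h1 := hmin.energy_le (h' := fun i => clamp lo hi (h i)) hK1 hK2 hK3 hab hlam hgm hgb ht hU
    hstrict ht
  have h2 := energy_clamp_add_le (K := K) (n := n) (h := h) hK1 hlam hgm hgb ht.mono
  have hnn : ∀ j ∈ Finset.range (n + 1),
      0 ≤ (h j - clamp lo hi (h j)) ^ 2 * (t (j + 1) - t j) := fun j _ =>
    mul_nonneg (sq_nonneg _) (sub_nonneg.2 (ht.mono (Nat.le_succ j)))
  have h3 : ∑ j ∈ Finset.range (n + 1), (h j - clamp lo hi (h j)) ^ 2 * (t (j + 1) - t j) ≤ 0 := by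
    have : lam / 2 * ∑ j ∈ Finset.range (n + 1),
      (h j - clamp lo hi (h j)) ^ 2 * (t (j + 1) - t j) ≤ 0 := by linarith
    exact nonpos_of_mul_nonpos_right this (half_pos hlam)
  have h4 := (Finset.sum_eq_zero_iff_of_nonneg hnn).1 (le_antisymm h3 (Finset.sum_nonneg hnn)) i
    (Finset.mem_range.2 (Nat.lt_succ_of_le hi'))
  have h5 : h i = clamp lo hi (h i) := by
    rcases mul_eq_zero.1 h4 with h5 | h5
    · exact sub_eq_zero.1 (pow_eq_zero_iff (two_ne_zero) |>.1 h5)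
    · exact absurd h5 (sub_pos.2 (hstrict i hi')).ne'
  rw [h5]
  exact clamp_mem ((hgb 0).1.trans (hgb 0).2) _

lemma IsMinimizer.ae_mem (hK1 : CondK1 K) (hK2 : CondK2 K) (hK3 : CondK3 K) (hab : a < b)
    (hlam : 0 < lam) (hgm : Measurable g) (hgb : ∀ x, g x ∈ Icc lo hi)
    (hmin : IsMinimizer a b lam K g U) (hU : IsPiecewiseConstant a b U) :
    ∀ᵐ x ∂volume.restrict (Ioo a b), U x ∈ Icc lo hi := by
  obtain ⟨_, _, _, ht₀, hU₀⟩ := exists_isStep_of_isPiecewiseConstant hab hU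
  obtain ⟨n, t, h, ht, hU, hstrict, -⟩ := hU₀.exists_reduced hab ht₀
  refine ht.ae_of_forall fun i hi => (hU i hi).mono fun x hx => ?_
  rw [hx]
  exact hmin.value_mem hK1 hK2 hK3 hab hlam hgm hgb ht hU hstrict hi

lemma IsMinimizer.encard_jumpSet_le {M C c : ℝ≥0} (hK1 : CondK1 K) (hK2 : CondK2 K)
    (hK3 : CondK3 K) (hab : a < b) (hlam : 0 < lam) (hgm : Measurable g)
    (hgb : ∀ x, g x ∈ Icc lo hi) (hJ : IsJumpBound K lo hi M C c)
    (hmin : IsMinimizer a b lam K g U) (hU : IsPiecewiseConstant a b U) :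
    (jumpSet a b U).encard ≤ ((⌊(b - a) * lam / min ((c : ℝ) / M) C⌋₊ + 1 : ℕ) : ℕ∞) := by
  obtain ⟨_, _, _, ht₀, hU₀⟩ := exists_isStep_of_isPiecewiseConstant hab hU
  obtain ⟨n, t, h, ht, hU, hstrict, hne⟩ := hU₀.exists_reduced hab ht₀
  have hle : ∀ h', energy lam K g n t h ≤ energy lam K g n t h' := fun h' =>
    hmin.energy_le hK1 hK2 hK3 hab hlam hgm hgb ht hU hstrict ht
  have hn : n ≤ ⌊(b - a) * lam / min ((c : ℝ) / M) C⌋₊ + 1 :=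
    le_floor_of_long_pieces hJ.min_pos hlam ht fun k hk =>
      min_le_mul_sub hK1 hlam hJ.pos hJ.sub_le hJ.isK2Const hJ.isLowerConst hgm hgb ht.mono hk
        (fun j hj => hmin.value_mem hK1 hK2 hK3 hab hlam hgm hgb ht hU hstrict hj)
        (hle _) (hle _) (hne k (by omega)) (hne (k + 1) hk)
  calc (jumpSet a b U).encard ≤ ((fun i => t (i + 1)) '' Iio n).encard :=
        encard_le_encard (hU.jumpSet_subset ht)
    _ ≤ (Iio n).encard := encard_image_le _ _
    _ = n := by rw [← Finset.coe_Iio, encard_coe_eq_coe_finsetCard, Nat.card_Iio]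
    _ ≤ _ := by exact_mod_cast hn

/-- The order on `ℝ` is only conditionally complete, so the essential bound from `MemLp` must be
supplied for `essSup` and `essInf` to be meaningful. -/
lemma ae_mem_Icc_essInf_essSup (hg : MemLp g ∞ (volume.restrict (Ioo a b))) :
    ∀ᵐ x ∂volume.restrict (Ioo a b), g x ∈ Icc (essInf g (volume.restrict (Ioo a b)))
      (essSup g (volume.restrict (Ioo a b))) := by
  obtain ⟨B, hB⟩ : ∃ B : ℝ, ∀ᵐ x ∂volume.restrict (Ioo a b), |g x| ≤ B := by
    refine ⟨(eLpNorm g ∞ (volume.restrict (Ioo a b))).toReal, ?_⟩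
    filter_upwards [ae_le_eLpNormEssSup (f := g) (μ := volume.restrict (Ioo a b))] with x hx
    rw [← eLpNorm_exponent_top] at hx
    rw [← Real.norm_eq_abs, ← toReal_enorm]
    exact ENNReal.toReal_mono hg.2.ne hx
  have h1 : IsBoundedUnder (· ≤ ·) (ae (volume.restrict (Ioo a b))) g :=
    ⟨B, eventually_map.2 (hB.mono fun x hx => (abs_le.1 hx).2)⟩
  have h2 : IsBoundedUnder (· ≥ ·) (ae (volume.restrict (Ioo a b))) g :=
    ⟨-B, eventually_map.2 (hB.mono fun x hx => (abs_le.1 hx).1)⟩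
  filter_upwards [ae_le_essSup h1, ae_essInf_le h2] with x h3 h4
  exact ⟨h4, h3⟩

end Minimizers

end KWC

theorem mainTheorem2 (a b lam : ℝ) (hab : a < b) (hlam : 0 < lam)
    (K : ℝ≥0 → ℝ≥0) (hK1 : KWC.CondK1 K) (hK2 : KWC.CondK2 K) (hK3 : KWC.CondK3 K)
    (g : ℝ → ℝ) (hg : MemLp g ∞ (volume.restrict (Ioo a b))) :
    (∃ U : ℝ → ℝ, KWC.IsMinimizer a b lam K g U ∧ KWC.IsPiecewiseConstant a b U) ∧
    ∀ U : ℝ → ℝ, KWC.IsMinimizer a b lam K g U → KWC.IsPiecewiseConstant a b U →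
      (∀ᵐ x ∂volume.restrict (Ioo a b),
        essInf g (volume.restrict (Ioo a b)) ≤ U x ∧
          U x ≤ essSup g (volume.restrict (Ioo a b))) ∧
      ∀ M C c : ℝ≥0, 0 < M →
        essSup g (volume.restrict (Ioo a b)) - essInf g (volume.restrict (Ioo a b)) ≤ M →
        KWC.IsK2Const K M C → KWC.IsLowerConst K M c →
        (KWC.jumpSet a b U).encard ≤
          ((⌊(b - a) * lam / min ((c : ℝ) / M) (C : ℝ)⌋₊ + 1 : ℕ) : ℕ∞) := by
  have hae := KWC.ae_mem_Icc_essInf_essSup hg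
  set lo := essInf g (volume.restrict (Ioo a b))
  set hi := essSup g (volume.restrict (Ioo a b))
  have hne : (ae (volume.restrict (Ioo a b))).NeBot := by
    rw [ae_neBot, Ne, Measure.restrict_eq_zero]
    simpa using hab
  have hlohi : lo ≤ hi := by
    obtain ⟨x, hx⟩ := hae.exists
    exact hx.1.trans hx.2
  -- A measurable representative of `g` with values in `[lo, hi]` everywhere; changing `g` on a null
  -- set does not affect who is a minimizer.
  let g' : ℝ → ℝ := fun x => KWC.clamp lo hi (hg.1.mk g x)
  have hgm : Measurable g' :=
    measurable_const.max (hg.1.stronglyMeasurable_mk.measurable.min measurable_const)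
  have hgb : ∀ x, g' x ∈ Icc lo hi := fun x => KWC.clamp_mem hlohi _
  have hgg : ∀ᵐ x ∂volume.restrict (Ioo a b), g x = g' x := by
    filter_upwards [hae, hg.1.ae_eq_mk] with x h1 h2
    simp only [g']
    rw [← h2, KWC.clamp_of_mem h1]
  simp only [KWC.isMinimizer_congr hgg]
  refine ⟨KWC.exists_isMinimizer hK1 hK2 hK3 hab hlam hgm hgb, fun U hU hpc => ⟨?_, ?_⟩⟩
  · exact hU.ae_mem hK1 hK2 hK3 hab hlam hgm hgb hpc
  · intro M C c hM hMle hC hc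
    exact hU.encard_jumpSet_le hK1 hK2 hK3 hab hlam hgm hgb ⟨hM, hMle, hC, hc⟩ hpc
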